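/- All graphs are finite and simple and $\log$ is the natural logarithm. For a graph $G$ let $d(G)$ be its average degree, $\delta(G)$ its minimum degree, and for $X\subseteq V(G)$ let $N_G(X)$ be the set of vertices outside $X$ that have a neighbour in $X$. For $\varepsilon_1>0$ and real $k>0$ put $\varepsilon(x)=0$ if $x<k/5$ and $\varepsilon(x)=\varepsilon_1/\log^2(15x/k)$ if $x\ge k/5$. A graph $G$ is an $(\varepsilon_1,k)$-robust-expander if for every $X\subseteq V(G)$ with $k/2\le |X|\le |V(G)|/2$ and every subgraph $F\subseteq G$ with $e(F)\le d(G)\,\varepsilon(|X|)\,|X|$ we have $|N_{G\setminus F}(X)|\ge \varepsilon(|X|)\,|X|$, where $G\setminus F$ is $G$ with the edges of $F$ removed. For integers $t,\ell\ge 0$ let $\mathsf{TK}_t^{(\ell)}$ denote the subdivision of the complete graph $K_t$ in which each edge is replaced by a path with exactly $\ell$ internal vertices (i.e. of length $\ell+1$), these paths being internally vertex-disjoint. **Theorem.** For all $0<\varepsilon_1,\varepsilon_2<1$ there is $K_0=K_0(\varepsilon_1,\varepsilon_2)$ such that the following holds for every $K\ge K_0$. Let $d>0$ be real and let $G$ be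 an $n$-vertex bipartite $(\varepsilon_1,\varepsilon_2 d)$-robust-expander with $\delta(G)\ge d$, $n\ge Kd$ and $d\ge (\log n)^{800}$, and set $m=\lfloor \log^4(n/d)\rfloor$. Then $G$ contains a copy of $\mathsf{TK}_{\lceil \sqrt d\, m\rceil}^{(\ell)}$ with $\ell=1$ or $\ell=80m^3-1$; that is, a balanced subdivision of the complete graph on $\lceil \sqrt d\, m\rceil$ vertices in which either all subdivided edges are paths of length $2$ or all are paths of length $80m^3$. -/

import Mathlib

namespace BalancedSubdivision

/-- The average degree `d(G)` of a finite graph. -/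
noncomputable def avgDegree {V : Type*} [Fintype V] (G : SimpleGraph V) [DecidableRel G.Adj] : ℝ :=
  (∑ v : V, (G.degree v : ℝ)) / (Fintype.card V : ℝ)

/-- The external neighbourhood `N_G(X)`: vertices outside `X` with a neighbour in `X`. -/
def extNbhd {V : Type*} (G : SimpleGraph V) (X : Set V) : Set V :=
  {w | w ∉ X ∧ ∃ v ∈ X, G.Adj v w}

/-- The expansion function `ε(x, ε₁, k)` (natural logarithm). -/
noncomputable def expansion (ε₁ k x : ℝ) : ℝ :=
  if x < k / 5 then 0 else ε₁ / Real.log (15 * x / k) ^ 2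

/-- `G` is an `(ε₁, k)`-robust-expander. The graph `G \ F` has the vertex set of `G` and the edge
set `E(G) \ E(F)`. -/
def IsRobustExpander {V : Type*} [Fintype V] (G : SimpleGraph V) [DecidableRel G.Adj]
    (ε₁ k : ℝ) : Prop :=
  ∀ X : Finset V, k / 2 ≤ (X.card : ℝ) → (X.card : ℝ) ≤ (Fintype.card V : ℝ) / 2 →
    ∀ F : SimpleGraph V, F ≤ G →
      (F.edgeSet.ncard : ℝ) ≤ avgDegree G * expansion ε₁ k X.card * X.card →
      expansion ε₁ k X.card * X.card ≤ ((extNbhd (G \ F) (X : Set V)).ncard : ℝ)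

/-- `G` contains a copy of `TK_t^(ℓ)`, a balanced subdivision of `K_t` in which every edge is
replaced by a path with exactly `ℓ` internal vertices (a path of length `ℓ + 1`): there are `t`
distinct branch vertices `c i` and, for every pair `i < j`, a path `P i j` in `G` from `c i` to
`c j` of length `ℓ + 1`, which meets no other branch vertex, and such that an internal vertex of
one path lies on no other path. -/
def ContainsTK {V : Type*} (G : SimpleGraph V) (t ℓ : ℕ) : Prop :=
  ∃ (c : Fin t ↪ V) (P : ∀ i j : Fin t, i < j → G.Walk (c i) (c j)),
    (∀ i j (h : i < j), (P i j h).IsPath ∧ (P i j h).length = ℓ + 1) ∧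
    (∀ i j (h : i < j) (k : Fin t), c k ∈ (P i j h).support → k = i ∨ k = j) ∧
    (∀ i j (h : i < j) i' j' (h' : i' < j'), (i, j) ≠ (i', j') →
      ∀ v ∈ (P i j h).support, v ≠ c i → v ≠ c j → v ∉ (P i' j' h').support)

/-- The parameter `m = ⌊log⁴ (n / d)⌋`. -/
noncomputable def mParam (n : ℕ) (d : ℝ) : ℕ := ⌊Real.log ((n : ℝ) / d) ^ 4⌋₊

end BalancedSubdivision

/-!
Robust expansion enters only through the fact that two large subsets of one side of the bipartition
are joined by a path of any prescribed even length in a wide range, even after a moderately large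
set of vertices is deleted. Indeed few inner vertices suffice to reach almost every vertex from
either set. The edges among the vertices reached include a dense part on which the length of the way
back is known, so a path in this part can be completed to a path of exactly the right length.

If `G` has no `1`-subdivision, then after deleting any `d m ^ 24` vertices some vertex of the larger
side still has half of its neighbours left: otherwise at least half of the edges at almost every
vertex of that side lead to a small set, in which dependent random choice finds branch vertices with
many common neighbours. So there are many disjoint stars. Joining leaves of a big star to leaves of
many others by disjoint paths of equal length produces hubs, which have so many disjoint sets of
leaves at the ends of their arms that most of these survive all later deletions. Finally the pairs
of hubs are treated one after the other: free arms of the two hubs are joined through their leaves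
by a path chosen so that the total length is `80 m ^ 3`.
-/

namespace BalancedSubdivision

open Finset SimpleGraph

section EdgeExpansion

variable {V : Type*} {G : SimpleGraph V} [DecidableRel G.Adj]

theorem card_interedges_eq_sum (X Z : Finset V) :
    #(G.interedges X Z) = ∑ x ∈ X, #{z ∈ Z | G.Adj x z} := by
  simp only [interedges, Rel.interedges, card_filter, sum_product]

theorem card_interedges_le_of_degree_lt {X Z : Finset V} {M : ℕ}
    (h : ∀ x ∈ X, #{z ∈ Z | G.Adj x z} < M) : #(G.interedges X Z) ≤ #X * M := by
  rw [card_interedges_eq_sum]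
  exact sum_le_card_nsmul X _ M fun x hx => (h x hx).le

variable [Fintype V] [DecidableEq V]

/-- The set of all vertices with a neighbour in `S`; it may meet `S`, unlike `extNbhd`. -/
def nbrs (G : SimpleGraph V) [DecidableRel G.Adj] (S : Finset V) : Finset V :=
  S.biUnion fun s => G.neighborFinset s

theorem mem_nbrs {S : Finset V} {v : V} : v ∈ nbrs G S ↔ ∃ s ∈ S, G.Adj s v := by
  simp [nbrs]

/-- The form in which robust expansion is used. A set `X` of at least `d` and at most half of the
vertices sends more than `d |X| / e` edges to any disjoint set `Z` that misses fewer than `|X| / e`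
of the vertices outside `X`. Here `1 / e` is a lower bound for the expansion function. -/
def EdgeExpanding (G : SimpleGraph V) [DecidableRel G.Adj] (d e : ℕ) : Prop :=
  ∀ X Z : Finset V, Disjoint X Z → d ≤ #X → 2 * #X ≤ Fintype.card V →
    e * #(X ∪ Z)ᶜ < #X → d * #X < e * #(G.interedges X Z)

theorem card_inter_nbrs_insert (Y S : Finset V) (x : V) :
    #(Y ∩ nbrs G (insert x S)) = #(Y ∩ nbrs G S) + #{y ∈ Y \ nbrs G S | G.Adj x y} := by
  rw [← card_union_of_disjoint]
  · congr 1
    ext v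
    simp only [mem_inter, mem_nbrs, mem_insert, exists_eq_or_imp, mem_union, mem_filter, mem_sdiff]
    by_cases h : ∃ s ∈ S, G.Adj s v <;> simp only [h] <;> tauto
  · exact disjoint_left.2 fun v hv hv' => (mem_sdiff.1 (mem_filter.1 hv').1).2 (mem_inter.1 hv).2

/-- The set `S` is chosen of maximal size, so no further vertex of `X` adds `M` neighbours. -/
theorem exists_saturated_subset (X Y : Finset V) {M : ℕ} (hM : 0 < M) (c : ℕ) :
    ∃ S ⊆ X, #S ≤ c ∧ M * #S ≤ #(Y ∩ nbrs G S) ∧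
      (#S = c ∨ ∀ x ∈ X, #{y ∈ Y \ nbrs G S | G.Adj x y} < M) := by
  obtain ⟨S, hS, hmax⟩ := exists_max_image
    (X.powerset.filter fun S => #S ≤ c ∧ M * #S ≤ #(Y ∩ nbrs G S)) card ⟨∅, by simp⟩
  simp only [mem_filter, mem_powerset] at hS hmax
  obtain ⟨hSX, hSc, hSM⟩ := hS
  refine ⟨S, hSX, hSc, hSM, ?_⟩
  by_contra! ⟨hne, x, hx, hxM⟩
  have hxS : x ∉ S := fun hxS => by
    have hgain := card_inter_nbrs_insert (G := G) Y S x
    rw [insert_eq_of_mem hxS] at hgain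
    omega
  have hcard : #(insert x S) = #S + 1 := card_insert_of_notMem hxS
  have hle := hmax (insert x S) ⟨insert_subset hx hSX, by omega, by
    rw [card_inter_nbrs_insert, hcard, Nat.mul_add]; omega⟩
  omega

namespace EdgeExpanding

variable {d e M : ℕ}

theorem exists_sparse_source (hG : EdgeExpanding G d e) (hM : 0 < M) (he : 0 < e) (hMd : M * e ≤ d)
    {X W : Finset V} (hX : d ≤ #X) (hXn : 2 * #X ≤ Fintype.card V) (hMX : 2 * M ≤ #X)
    (hW : 2 * e * #W < #X) :
    ∃ S ⊆ X, M * #S ≤ #X ∧ #X ≤ 2 * e * #((X ∪ W)ᶜ ∩ nbrs G S) := by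
  obtain ⟨S, hSX, hSc, hS, hfull | hsat⟩ :=
    exists_saturated_subset (G := G) X (X ∪ W)ᶜ hM (#X / M)
  · refine ⟨S, hSX, (Nat.mul_le_mul_left M hSc).trans (Nat.mul_div_le _ _), ?_⟩
    rw [hfull] at hS
    have := Nat.div_add_mod #X M
    have := Nat.mod_lt #X hM
    nlinarith
  refine ⟨S, hSX, (Nat.mul_le_mul_left M hSc).trans (Nat.mul_div_le _ _), ?_⟩
  by_contra! hlt
  set Z := (X ∪ W)ᶜ \ nbrs G S
  have hXZ : Disjoint X Z := disjoint_left.2 fun v hv hv' => by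
    simp only [Z, mem_sdiff, mem_compl, mem_union] at hv'
    tauto
  have hcompl : (X ∪ Z)ᶜ ⊆ W ∪ ((X ∪ W)ᶜ ∩ nbrs G S) := fun v => by
    simp only [Z, mem_sdiff, mem_compl, mem_union, mem_inter]
    tauto
  have hmissed := (card_le_card hcompl).trans (card_union_le _ _)
  have hmany := hG X Z hXZ hX hXn (by nlinarith)
  have hfew := Nat.mul_le_mul_left e (card_interedges_le_of_degree_lt hsat)
  nlinarith

theorem exists_sparse_cover (hG : EdgeExpanding G d e) (hM : 0 < M) {R W : Finset V} {δ : ℕ}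
    (hdδ : d ≤ δ) (hδ : e * M * Fintype.card V ≤ d * δ) (hW : 2 * e * #W < δ)
    (hR : 2 * #(R ∪ W)ᶜ ≤ Fintype.card V) :
    ∃ S ⊆ R \ W, M * #S ≤ Fintype.card V ∧ (#((R ∪ W)ᶜ \ nbrs G S) < δ ∨
      (2 * e + 1) * #((R ∪ W)ᶜ \ nbrs G S) ≤ 2 * e * #(R ∪ W)ᶜ) := by
  obtain ⟨S, hSR, -, hS, hor⟩ :=
    exists_saturated_subset (G := G) (R \ W) (R ∪ W)ᶜ hM (#(R \ W) + 1)
  refine ⟨S, hSR, hS.trans (card_le_univ _), ?_⟩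
  have hsat := hor.resolve_left (by have := card_le_card hSR; omega)
  by_contra! ⟨hbig, hslow⟩
  set Y := (R ∪ W)ᶜ
  set Z := Y \ nbrs G S
  have hsplit : #(Y ∩ nbrs G S) + #Z = #Y := card_inter_add_card_sdiff _ _
  have hZR : Disjoint Z (R \ W) := disjoint_left.2 fun v hv hv' => by
    simp only [Z, Y, mem_sdiff, mem_compl, mem_union] at hv hv'
    tauto
  have hcompl : (Z ∪ (R \ W))ᶜ ⊆ W ∪ (Y ∩ nbrs G S) := fun v => by
    simp only [Z, Y, mem_sdiff, mem_compl, mem_union, mem_inter]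
    tauto
  have hmissed := (card_le_card hcompl).trans (card_union_le _ _)
  have hmany := hG Z (R \ W) hZR (by omega) (by omega) (by nlinarith)
  have hfew : e * #(G.interedges Z (R \ W)) ≤ e * (Fintype.card V * M) := by
    have := G.symm
    rw [interedges, Rel.card_interedges_comm]
    exact Nat.mul_le_mul_left _ ((card_interedges_le_of_degree_lt hsat).trans
      (Nat.mul_le_mul_right _ (card_le_univ _)))
  have hdZ : d * δ ≤ d * #Z := Nat.mul_le_mul_left _ hbig
  nlinarith

end EdgeExpanding

end EdgeExpansion

section Growth

variable {V : Type*} {G : SimpleGraph V}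

/-- There is a walk of length at most `i` from `v` to `A` all of whose vertices lie in `U`, with the
possible exception of `v` itself. -/
def Reach (G : SimpleGraph V) (A U : Finset V) (i : ℕ) (v : V) : Prop :=
  ∃ a ∈ A, ∃ p : G.Walk v a, p.length ≤ i ∧ ∀ z ∈ p.support, z = v ∨ z ∈ U

namespace Reach

variable {A U U' : Finset V} {i j : ℕ} {s v : V}

theorem mono (h : Reach G A U i v) (hU : U ⊆ U') (hij : i ≤ j) : Reach G A U' j v := by
  obtain ⟨a, ha, p, hp, hpU⟩ := h
  exact ⟨a, ha, p, hp.trans hij, fun z hz => (hpU z hz).imp_right fun h => hU h⟩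

theorem of_mem (h : v ∈ A) : Reach G A U 0 v :=
  ⟨v, h, Walk.nil, by simp, by simp⟩

theorem step (h : Reach G A U i s) (hs : s ∈ U) (hsv : G.Adj s v) : Reach G A U (i + 1) v := by
  obtain ⟨a, ha, p, hp, hpU⟩ := h
  refine ⟨a, ha, Walk.cons hsv.symm p, by simpa using hp, fun z hz => ?_⟩
  rw [Walk.support_cons, List.mem_cons] at hz
  refine hz.imp_right fun hz => ?_
  rcases hpU z hz with rfl | hzU
  · exact hs
  · exact hzU

theorem exists_isPath (h : Reach G A U i v) :
    ∃ a ∈ A, ∃ p : G.Walk v a, p.IsPath ∧ p.length ≤ i ∧ ∀ z ∈ p.support, z = v ∨ z ∈ U := by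
  classical
  obtain ⟨a, ha, p, hp, hpU⟩ := h
  exact ⟨a, ha, p.bypass, p.bypass_isPath, p.length_bypass_le_length.trans hp,
    fun z hz => hpU z (p.support_bypass_subset_support hz)⟩

end Reach

/-- After `i` rounds of exploration from `A`, all vertices of `R` have been reached through `U`,
which avoids `W`. There are at least `x` of them, and each round added at most `x / M` vertices
to `U`. -/
structure Growth (G : SimpleGraph V) (A W : Finset V) (M i x : ℕ) (R U : Finset V) : Prop where
  disjoint : Disjoint U W
  reach : ∀ v ∈ R, Reach G A U i v
  le_card : x ≤ #R
  mul_card_le : M * #U ≤ i * x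

namespace Growth

variable {A W R U : Finset V} {M i j x y : ℕ}

theorem zero (hx : x ≤ #A) : Growth G A W M 0 x A ∅ :=
  ⟨disjoint_empty_left W, fun _ hv => Reach.of_mem hv, hx, by simp⟩

theorem mono (h : Growth G A W M i x R U) (hij : i ≤ j) (hxy : x ≤ y) (hy : y ≤ #R) :
    Growth G A W M j y R U :=
  ⟨h.disjoint, fun v hv => (h.reach v hv).mono subset_rfl hij, hy,
    h.mul_card_le.trans (Nat.mul_le_mul hij hxy)⟩

theorem of_disjoint {W' : Finset V} (h : Growth G A W M i x R U) (hW' : Disjoint U W') :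
    Growth G A W' M i x R U :=
  { h with disjoint := hW' }

end Growth

variable [Fintype V] [DecidableEq V] [DecidableRel G.Adj]

theorem Reach.of_mem_union_nbrs {A R U S : Finset V} {i : ℕ} {v : V}
    (hR : ∀ v ∈ R, Reach G A U i v) (hS : S ⊆ R) (hv : v ∈ R ∪ nbrs G S) :
    Reach G A (U ∪ S) (i + 1) v := by
  rcases mem_union.1 hv with hv | hv
  · exact (hR v hv).mono subset_union_left i.le_succ
  · obtain ⟨s, hs, hsv⟩ := mem_nbrs.1 hv
    exact ((hR s (hS hs)).mono subset_union_left le_rfl).step (mem_union_right _ hs) hsv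

namespace EdgeExpanding

variable {d e M : ℕ} {A B W R U : Finset V} {i x r δ : ℕ}

theorem exists_growth_succ (hG : EdgeExpanding G d e) (hM : 0 < M) (he : 0 < e) (hMd : M * e ≤ d)
    (h : Growth G A W M i x R U) (hxn : 2 * x ≤ Fintype.card V) (hW : (4 * e + 2) * #W ≤ x)
    (hdx : 2 * d ≤ x) (hMx : 4 * M ≤ x) :
    ∃ R' U', (4 * e + 1) * x ≤ 4 * e * #R' ∧ Growth G A W M (i + 1) x R' U' := by
  have hWx : 6 * #W ≤ x := by nlinarith
  have hRW : x - #W ≤ #(R \ W) := (Nat.sub_le_sub_right h.le_card _).trans (le_card_sdiff W R)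
  obtain ⟨X, hXR, hXc⟩ := exists_subset_card_eq hRW
  have hXW : #X + #W = x := by omega
  obtain ⟨S, hSX, hS, hgrow⟩ := hG.exists_sparse_source hM he hMd (X := X) (W := W) (by omega)
    (by omega) (by omega) (by nlinarith)
  set N := (X ∪ W)ᶜ ∩ nbrs G S
  have hXN : Disjoint X N := disjoint_left.2 fun v hv hv' => by
    simp only [N, mem_inter, mem_compl, mem_union] at hv'
    tauto
  have hcard : (4 * e + 1) * x ≤ 4 * e * #(X ∪ N) := by
    rw [card_union_of_disjoint hXN]
    nlinarith
  refine ⟨X ∪ N, U ∪ S, hcard, ?_, fun v hv => ?_, ?_, ?_⟩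
  · exact disjoint_union_left.2 ⟨h.disjoint, disjoint_of_subset_left (hSX.trans hXR) sdiff_disjoint⟩
  · exact Reach.of_mem_union_nbrs (fun v hv => h.reach v (mem_sdiff.1 (hXR hv)).1) hSX
      (union_subset_union_right inter_subset_right hv)
  · by_contra! hlt
    nlinarith
  · calc M * #(U ∪ S) ≤ M * (#U + #S) := Nat.mul_le_mul_left M (card_union_le U S)
      _ ≤ (i + 1) * x := by rw [Nat.mul_add, Nat.add_mul]; have := h.mul_card_le; omega

/-- The two explorations take turns, each treating the other's inner vertices as forbidden. -/
theorem exists_twin_growth_succ (hG : EdgeExpanding G d e) (hM : 0 < M) (he : 0 < e)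
    (hMd : M * e ≤ d) {RA UA RB UB : Finset V} (hA : Growth G A (W ∪ UB) M i x RA UA)
    (hB : Growth G B (W ∪ UA) M i x RB UB) (hxn : 2 * x ≤ Fintype.card V) (hdx : 2 * d ≤ x)
    (hMx : 4 * M ≤ x) (hW : 2 * (4 * e + 2) * #W ≤ x) (hiM : 2 * (4 * e + 2) * (i + 1) ≤ M) :
    ∃ y RA' UA' RB' UB', x ≤ y ∧ (4 * e + 1) * x ≤ 4 * e * y ∧
      Growth G A (W ∪ UB') M (i + 1) y RA' UA' ∧ Growth G B (W ∪ UA') M (i + 1) y RB' UB' := by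
  have small {U : Finset V} (hU : M * #U ≤ (i + 1) * x) : (4 * e + 2) * #(W ∪ U) ≤ x := by
    have hcost : (i + 1) * (2 * (4 * e + 2) * #U) ≤ (i + 1) * x := by
      calc (i + 1) * (2 * (4 * e + 2) * #U) = 2 * (4 * e + 2) * (i + 1) * #U := by ring
        _ ≤ M * #U := Nat.mul_le_mul_right _ hiM
        _ ≤ (i + 1) * x := hU
    have hUx := Nat.le_of_mul_le_mul_left hcost i.succ_pos
    have hunion := Nat.mul_le_mul_left (4 * e + 2) (card_union_le W U)
    nlinarith
  obtain ⟨RA', UA', hgrowA, hA'⟩ := hG.exists_growth_succ hM he hMd hA hxn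
    (small (hB.mul_card_le.trans (Nat.mul_le_mul_right _ i.le_succ))) hdx hMx
  obtain ⟨hAW, hAB⟩ := disjoint_union_right.1 hA'.disjoint
  have hBW := (disjoint_union_right.1 hB.disjoint).1
  obtain ⟨RB', UB', hgrowB, hB'⟩ := hG.exists_growth_succ hM he hMd
    (hB.of_disjoint (disjoint_union_right.2 ⟨hBW, hAB.symm⟩)) hxn (small hA'.mul_card_le) hdx hMx
  have hBA := (disjoint_union_right.1 hB'.disjoint).2
  have hx : x ≤ min #RA' #RB' := le_min hA'.le_card hB'.le_card
  refine ⟨min #RA' #RB', RA', UA', RB', UB', hx, ?_, ?_, hB'.mono le_rfl hx (min_le_right _ _)⟩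
  · rcases min_choice #RA' #RB' with h | h <;> rwa [h]
  · exact (hA'.of_disjoint (disjoint_union_right.2 ⟨hAW, hBA.symm⟩)).mono le_rfl hx
      (min_le_left _ _)

theorem exists_twin_growth (hG : EdgeExpanding G d e) (hM : 0 < M) (he : 0 < e) (hMd : M * e ≤ d)
    {D : ℕ} (hA : D ≤ #A) (hB : D ≤ #B) (hdD : 2 * d ≤ D) (hMD : 4 * M ≤ D)
    (hW : 2 * (4 * e + 2) * #W ≤ D) (hiM : 2 * (4 * e + 2) * i ≤ M) :
    ∃ x RA UA RB UB, D ≤ x ∧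
      Growth G A (W ∪ UB) M i x RA UA ∧ Growth G B (W ∪ UA) M i x RB UB ∧
      (Fintype.card V ≤ 2 * x ∨ (4 * e + 1) ^ i * D ≤ (4 * e) ^ i * x) := by
  induction i with
  | zero => exact ⟨D, A, ∅, B, ∅, le_rfl, Growth.zero hA, Growth.zero hB, by simp⟩
  | succ i ih =>
    obtain ⟨x, RA, UA, RB, UB, hDx, hgA, hgB, hor⟩ := ih (by nlinarith)
    by_cases hx : Fintype.card V ≤ 2 * x
    · exact ⟨x, RA, UA, RB, UB, hDx, hgA.mono i.le_succ le_rfl hgA.le_card,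
        hgB.mono i.le_succ le_rfl hgB.le_card, Or.inl hx⟩
    obtain ⟨y, RA', UA', RB', UB', hxy, hgrow, hgA', hgB'⟩ := hG.exists_twin_growth_succ hM he hMd
      hgA hgB (by omega) (by omega) (by omega) (by omega) hiM
    refine ⟨y, RA', UA', RB', UB', hDx.trans hxy, hgA', hgB', Or.inr ?_⟩
    calc (4 * e + 1) ^ (i + 1) * D = (4 * e + 1) * ((4 * e + 1) ^ i * D) := by ring
      _ ≤ (4 * e + 1) * ((4 * e) ^ i * x) := Nat.mul_le_mul_left _ (hor.resolve_left hx)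
      _ = (4 * e) ^ i * ((4 * e + 1) * x) := by ring
      _ ≤ (4 * e) ^ i * (4 * e * y) := Nat.mul_le_mul_left _ hgrow
      _ = (4 * e) ^ (i + 1) * y := by ring

theorem exists_twin_growth_half (hG : EdgeExpanding G d e) (hM : 0 < M) (he : 0 < e)
    (hMd : M * e ≤ d) {D : ℕ} (hA : D ≤ #A) (hB : D ≤ #B) (hdD : 2 * d ≤ D) (hMD : 4 * M ≤ D)
    (hW : 2 * (4 * e + 2) * #W ≤ D) (hrM : 2 * (4 * e + 2) * r ≤ M)
    (hrn : Fintype.card V * (4 * e) ^ r ≤ d * (4 * e + 1) ^ r) :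
    ∃ x RA UA RB UB, Fintype.card V ≤ 2 * x ∧
      Growth G A (W ∪ UB) M r x RA UA ∧ Growth G B (W ∪ UA) M r x RB UB := by
  obtain ⟨x, RA, UA, RB, UB, -, hgA, hgB, hhalf | hgrow⟩ :=
    hG.exists_twin_growth hM he hMd hA hB hdD hMD hW hrM
  · exact ⟨x, RA, UA, RB, UB, hhalf, hgA, hgB⟩
  refine ⟨x, RA, UA, RB, UB, ?_, hgA, hgB⟩
  have hscaled : (4 * e) ^ r * Fintype.card V ≤ (4 * e) ^ r * x := by
    calc (4 * e) ^ r * Fintype.card V = Fintype.card V * (4 * e) ^ r := mul_comm _ _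
      _ ≤ d * (4 * e + 1) ^ r := hrn
      _ ≤ (4 * e + 1) ^ r * D := by rw [mul_comm]; exact Nat.mul_le_mul_left _ (by omega)
      _ ≤ (4 * e) ^ r * x := hgrow
  have := Nat.le_of_mul_le_mul_left hscaled (by positivity)
  omega

theorem exists_cover_succ (hG : EdgeExpanding G d e) (hM : 0 < M) (hdδ : d ≤ δ)
    (hδ : e * M * Fintype.card V ≤ d * δ) (hW : 2 * e * #W < δ) (hn : Fintype.card V ≤ 2 * #R)
    (hUW : Disjoint U W) (hR : ∀ v ∈ R, Reach G A U i v) :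
    ∃ R' U', R ⊆ R' ∧ U ⊆ U' ∧ Disjoint U' W ∧ M * #U' ≤ M * #U + Fintype.card V ∧
      (∀ v ∈ R', Reach G A U' (i + 1) v) ∧
      (#(R' ∪ W)ᶜ < δ ∨ (2 * e + 1) * #(R' ∪ W)ᶜ ≤ 2 * e * #(R ∪ W)ᶜ) := by
  have hcompl : 2 * #(R ∪ W)ᶜ ≤ Fintype.card V := by
    rw [card_compl]
    have := card_le_card (subset_union_left (s₁ := R) (s₂ := W))
    omega
  obtain ⟨S, hSR, hS, hshrink⟩ := hG.exists_sparse_cover hM hdδ hδ hW hcompl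
  have hunreached : (R ∪ nbrs G S ∪ W)ᶜ = (R ∪ W)ᶜ \ nbrs G S := by
    ext v
    simp only [mem_compl, mem_union, mem_sdiff]
    tauto
  refine ⟨R ∪ nbrs G S, U ∪ S, subset_union_left, subset_union_left, ?_, ?_, fun v hv => ?_,
    hunreached ▸ hshrink⟩
  · exact disjoint_union_left.2 ⟨hUW, disjoint_of_subset_left hSR sdiff_disjoint⟩
  · have := Nat.mul_le_mul_left M (card_union_le U S)
    rw [Nat.mul_add] at this
    omega
  · exact Reach.of_mem_union_nbrs hR (hSR.trans sdiff_subset) hv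

theorem exists_cover (hG : EdgeExpanding G d e) (hM : 0 < M) (hdδ : d ≤ δ)
    (hδ : e * M * Fintype.card V ≤ d * δ) (hW : 2 * e * #W < δ) (hn : Fintype.card V ≤ 2 * #R)
    (hUW : Disjoint U W) (hR : ∀ v ∈ R, Reach G A U i v)
    (hr : (2 * e) ^ r * Fintype.card V < (2 * e + 1) ^ r * δ) :
    ∃ R' U', U ⊆ U' ∧ Disjoint U' W ∧ M * #U' ≤ M * #U + r * Fintype.card V ∧
      (∀ v ∈ R', Reach G A U' (i + r) v) ∧ #(R' ∪ W)ᶜ < δ := by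
  have key (j : ℕ) : ∃ R' U', R ⊆ R' ∧ U ⊆ U' ∧ Disjoint U' W ∧
      M * #U' ≤ M * #U + j * Fintype.card V ∧ (∀ v ∈ R', Reach G A U' (i + j) v) ∧
      (#(R' ∪ W)ᶜ < δ ∨ (2 * e + 1) ^ j * #(R' ∪ W)ᶜ ≤ (2 * e) ^ j * Fintype.card V) := by
    induction j with
    | zero =>
      exact ⟨R, U, subset_rfl, subset_rfl, hUW, by simp, hR, Or.inr (by simpa using card_le_univ _)⟩
    | succ j ih =>
      obtain ⟨R₁, U₁, hsub₁, hU₁, hdisj₁, hcost₁, hreach₁, hor₁⟩ := ih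
      obtain ⟨R₂, U₂, hsub₂, hU₂, hdisj₂, hcost₂, hreach₂, hor₂⟩ :=
        hG.exists_cover_succ hM hdδ hδ hW
          (hn.trans (Nat.mul_le_mul_left _ (card_le_card hsub₁))) hdisj₁ hreach₁
      refine ⟨R₂, U₂, hsub₁.trans hsub₂, hU₁.trans hU₂, hdisj₂, by rw [Nat.add_mul]; omega, hreach₂,
        ?_⟩
      rcases hor₁ with hdone | hor₁
      · exact Or.inl ((card_le_card (compl_subset_compl.2
          (union_subset_union_left hsub₂))).trans_lt hdone)
      refine hor₂.imp_right fun hor₂ => ?_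
      calc (2 * e + 1) ^ (j + 1) * #(R₂ ∪ W)ᶜ
          = (2 * e + 1) ^ j * ((2 * e + 1) * #(R₂ ∪ W)ᶜ) := by ring
        _ ≤ (2 * e + 1) ^ j * (2 * e * #(R₁ ∪ W)ᶜ) := Nat.mul_le_mul_left _ hor₂
        _ = 2 * e * ((2 * e + 1) ^ j * #(R₁ ∪ W)ᶜ) := by ring
        _ ≤ 2 * e * ((2 * e) ^ j * Fintype.card V) := Nat.mul_le_mul_left _ hor₁
        _ = (2 * e) ^ (j + 1) * Fintype.card V := by ring
  obtain ⟨R', U', -, hU, hdisj, hcost, hreach, hdone | hgrow⟩ := key r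
  · exact ⟨R', U', hU, hdisj, hcost, hreach, hdone⟩
  · exact ⟨R', U', hU, hdisj, hcost, hreach, Nat.lt_of_mul_lt_mul_left (hgrow.trans_lt hr)⟩

theorem exists_common_reach (hG : EdgeExpanding G d e) (hM : 0 < M) (he : 0 < e) (hMd : M * e ≤ d)
    {D : ℕ} (hA : D ≤ #A) (hB : D ≤ #B) (hdD : 2 * d ≤ D) (hMD : 4 * M ≤ D)
    (hW : 2 * (4 * e + 2) * #W ≤ D) (hrM : 2 * (4 * e + 2) * r ≤ M)
    (hrn : Fintype.card V * (4 * e) ^ r ≤ d * (4 * e + 1) ^ r) (hdδ : d ≤ δ)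
    (hδ : e * M * Fintype.card V ≤ d * δ) (hr : (2 * e) ^ r * Fintype.card V < (2 * e + 1) ^ r * δ)
    (hsmall : ∀ U : Finset V, M * #U ≤ 2 * r * Fintype.card V → 2 * e * #(W ∪ U) < δ) :
    ∃ UA UB Z, Disjoint UA (W ∪ UB) ∧ Disjoint UB (W ∪ UA) ∧ Disjoint Z (W ∪ UA ∪ UB) ∧
      (∀ v ∈ Z, Reach G A UA (2 * r) v) ∧ (∀ v ∈ Z, Reach G B UB (2 * r) v) ∧
      M * #UA ≤ 2 * r * Fintype.card V ∧ M * #UB ≤ 2 * r * Fintype.card V ∧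
      #Zᶜ ≤ #W + #UA + #UB + 2 * δ := by
  obtain ⟨x, RA₀, UA₀, RB₀, UB₀, hx, hgA, hgB⟩ :=
    hG.exists_twin_growth_half hM he hMd hA hB hdD hMD hW hrM hrn
  have hrx : r * x ≤ r * Fintype.card V :=
    Nat.mul_le_mul_left _ (hgA.le_card.trans (card_le_univ _))
  have hcostA₀ := hgA.mul_card_le.trans hrx
  have hcostB₀ := hgB.mul_card_le.trans hrx
  rw [mul_assoc] at hsmall ⊢
  obtain ⟨RA, UA, -, hdisjA, hcostA, hreachA, hcovA⟩ := hG.exists_cover hM hdδ hδ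
    (hsmall UB₀ (by omega)) (hx.trans (Nat.mul_le_mul_left 2 hgA.le_card)) hgA.disjoint hgA.reach hr
  obtain ⟨hAW, hAB₀⟩ := disjoint_union_right.1 hdisjA
  obtain ⟨RB, UB, hUB, hdisjB, hcostB, hreachB, hcovB⟩ := hG.exists_cover hM hdδ hδ
    (hsmall UA (by omega)) (hx.trans (Nat.mul_le_mul_left 2 hgB.le_card))
    (disjoint_union_right.2 ⟨(disjoint_union_right.1 hgB.disjoint).1, hAB₀.symm⟩) hgB.reach hr
  rw [← two_mul] at hreachA hreachB
  refine ⟨UA, UB, (RA ∩ RB) \ (W ∪ UA ∪ UB),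
    disjoint_union_right.2 ⟨hAW, (disjoint_union_right.1 hdisjB).2.symm⟩, hdisjB, sdiff_disjoint,
    fun v hv => hreachA v (mem_inter.1 (mem_sdiff.1 hv).1).1,
    fun v hv => hreachB v (mem_inter.1 (mem_sdiff.1 hv).1).2, by omega, by omega, ?_⟩
  have hsub : ((RA ∩ RB) \ (W ∪ UA ∪ UB))ᶜ ⊆
      (W ∪ UA ∪ UB) ∪ ((RA ∪ (W ∪ UB₀))ᶜ ∪ (RB ∪ (W ∪ UA))ᶜ) := fun v => by
    have := @hUB v
    simp only [mem_compl, mem_sdiff, mem_union, mem_inter]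
    tauto
  have := card_le_card hsub
  have := card_union_le (W ∪ UA ∪ UB) ((RA ∪ (W ∪ UB₀))ᶜ ∪ (RB ∪ (W ∪ UA))ᶜ)
  have := card_union_le (W ∪ UA) UB
  have := card_union_le W UA
  have := card_union_le (RA ∪ (W ∪ UB₀))ᶜ (RB ∪ (W ∪ UA))ᶜ
  omega

end EdgeExpanding

end Growth

section ExactLength

variable {V : Type*} {G : SimpleGraph V}

theorem isPath_append {u v w : V} {p : G.Walk u v} {q : G.Walk v w} (hp : p.IsPath) (hq : q.IsPath)
    (h : ∀ z ∈ p.support, z ∈ q.support → z = v) : (p.append q).IsPath := by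
  rw [Walk.isPath_def, Walk.support_append]
  have hq' := hq.support_nodup
  rw [← Walk.cons_tail_support, List.nodup_cons] at hq'
  refine List.Nodup.append hp.support_nodup hq'.2 fun z hz hz' => ?_
  obtain rfl := h z hz (List.mem_of_mem_tail hz')
  exact hq'.1 hz'

/-- Each of the two outer paths is allowed to meet the middle one only in the common end. -/
theorem isPath_reverse_append_append {UA UB Z : Finset V} {a b x y : V} (hUU : Disjoint UA UB)
    (hZA : Disjoint Z UA) (hZB : Disjoint Z UB) {p : G.Walk y a} {q : G.Walk y x} {s : G.Walk x b}
    (hp : p.IsPath) (hpU : ∀ z ∈ p.support, z = y ∨ z ∈ UA) (hq : q.IsPath)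
    (hqZ : ∀ z ∈ q.support, z ∈ Z) (hs : s.IsPath) (hsU : ∀ z ∈ s.support, z = x ∨ z ∈ UB) :
    (p.reverse.append (q.append s)).IsPath := by
  rw [Finset.disjoint_left] at hUU hZA hZB
  have hqs : (q.append s).IsPath := isPath_append hq hs fun v hv hv' =>
    (hsU v hv').resolve_right (hZB (hqZ v hv))
  refine isPath_append hp.reverse hqs fun v hv hv' => ?_
  rw [Walk.support_reverse, List.mem_reverse] at hv
  refine (hpU v hv).resolve_right fun hvA => ?_
  rcases (Walk.mem_support_append_iff q s).1 hv' with hv' | hv'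
  · exact hZA (hqZ v hv') hvA
  · rcases hsU v hv' with rfl | hvB
    · exact hZA (hqZ v q.end_mem_support) hvA
    · exact hUU hvA hvB

section Core

variable (H : SimpleGraph V) [DecidableRel H.Adj]

theorem card_interedges_self_le [DecidableEq V] (S : Finset V) (v : V) :
    #(H.interedges S S) ≤ #(H.interedges (S.erase v) (S.erase v)) + 2 * #{w ∈ S | H.Adj v w} := by
  have hsub : H.interedges S S ⊆ H.interedges (S.erase v) (S.erase v) ∪
      ({v} ×ˢ {w ∈ S | H.Adj v w} ∪ {w ∈ S | H.Adj v w} ×ˢ {v}) := by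
    rintro ⟨x, y⟩ hxy
    have := H.adj_comm x y
    simp only [interedges, Rel.mem_interedges_iff, mem_union, mem_product, mem_singleton,
      mem_filter, mem_erase] at hxy ⊢
    grind
  have := card_le_card hsub
  have := card_union_le (H.interedges (S.erase v) (S.erase v))
    ({v} ×ˢ {w ∈ S | H.Adj v w} ∪ {w ∈ S | H.Adj v w} ×ˢ {v})
  have := card_union_le ({v} ×ˢ {w ∈ S | H.Adj v w}) ({w ∈ S | H.Adj v w} ×ˢ {v})
  simp only [card_product, card_singleton, one_mul, mul_one] at this
  omega

theorem exists_subset_forall_le_degree {k : ℕ} {S : Finset V}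
    (h : 2 * k * #S < #(H.interedges S S)) :
    ∃ T ⊆ S, T.Nonempty ∧ ∀ v ∈ T, k ≤ #{w ∈ T | H.Adj v w} := by
  classical
  obtain ⟨T, hT, hmin⟩ := exists_min_image
    (S.powerset.filter fun T => 2 * k * #T < #(H.interedges T T)) card ⟨S, by simpa using h⟩
  simp only [mem_filter, mem_powerset] at hT hmin
  have hne : T.Nonempty := by
    rw [nonempty_iff_ne_empty]
    rintro rfl
    simp [interedges, Rel.interedges] at hT
  refine ⟨T, hT.1, hne, fun v hv => ?_⟩
  by_contra! hlt
  have hcard := card_erase_add_one hv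
  have hdense : 2 * k * #(T.erase v) < #(H.interedges (T.erase v) (T.erase v)) := by
    have := card_interedges_self_le H T v
    have : 2 * k * #T = 2 * k * #(T.erase v) + 2 * k := by rw [← hcard]; ring
    omega
  have := hmin (T.erase v) ⟨(erase_subset _ _).trans hT.1, hdense⟩
  omega

theorem exists_isPath_of_forall_le_degree {k : ℕ} {S : Finset V}
    (hS : ∀ v ∈ S, k ≤ #{w ∈ S | H.Adj v w}) {x : V} (hx : x ∈ S) {l : ℕ} (hl : l ≤ k) :
    ∃ y ∈ S, ∃ p : H.Walk y x, p.IsPath ∧ p.length = l ∧ ∀ z ∈ p.support, z ∈ S := by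
  classical
  induction l with
  | zero => exact ⟨x, hx, Walk.nil, by simp, by simp, by simpa using hx⟩
  | succ l ih =>
    obtain ⟨y, hy, p, hp, hpl, hpS⟩ := ih (by omega)
    have hcard : #(p.support.toFinset.erase y) < #{w ∈ S | H.Adj y w} := by
      rw [card_erase_of_mem (by simp), List.toFinset_card_of_nodup hp.support_nodup,
        Walk.length_support]
      have := hS y hy
      omega
    obtain ⟨w, hw, hwp⟩ := exists_mem_notMem_of_card_lt_card hcard
    obtain ⟨hwS, hyw⟩ := mem_filter.1 hw
    have hw_new : w ∉ p.support := fun h =>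
      hwp (mem_erase.2 ⟨hyw.ne', List.mem_toFinset.2 h⟩)
    refine ⟨w, hwS, Walk.cons hyw.symm p, hp.cons hw_new, by simp [hpl], ?_⟩
    simpa using ⟨hwS, hpS⟩

end Core

section Labels

/-- The subgraph formed by the edges whose ends carry the labels `a` and `b`, in either order. In a
subgraph of it without isolated vertices, the parity of a label determines the label. -/
def labelGraph (G : SimpleGraph V) (h : V → ℕ) (a b : ℕ) : SimpleGraph V where
  Adj u v := G.Adj u v ∧ s(h u, h v) = s(a, b)
  symm := ⟨fun _ _ huv => ⟨huv.1.symm, Sym2.eq_swap.trans huv.2⟩⟩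
  loopless := ⟨fun _ hu => G.loopless.irrefl _ hu.1⟩

variable {h : V → ℕ} {a b i : ℕ}

instance [DecidableRel G.Adj] : DecidableRel (labelGraph G h a b).Adj :=
  fun u v => inferInstanceAs (Decidable (G.Adj u v ∧ s(h u, h v) = s(a, b)))

theorem exists_dense_labelGraph [DecidableRel G.Adj] {Z : Finset V} {N : ℕ}
    (hi : ∀ v ∈ Z, h v ≤ i) (hN : (i + 1) * (i + 1) * N < #(G.interedges Z Z)) :
    ∃ a b, N < #((labelGraph G h a b).interedges Z Z) := by
  obtain ⟨⟨a, b⟩, -, hfib⟩ := exists_lt_card_fiber_of_mul_lt_card_of_maps_to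
    (s := G.interedges Z Z) (t := range (i + 1) ×ˢ range (i + 1))
    (f := fun p => (h p.1, h p.2)) (n := N) (fun p hp => by
      obtain ⟨h1, h2, -⟩ := Rel.mem_interedges_iff.1 hp
      simp only [mem_product, mem_range]
      exact ⟨Nat.lt_succ_of_le (hi _ h1), Nat.lt_succ_of_le (hi _ h2)⟩)
    (by simpa using hN)
  refine ⟨a, b, hfib.trans_le (card_le_card fun p hp => ?_)⟩
  simp only [mem_filter, interedges, Rel.mem_interedges_iff, Prod.mk.injEq] at hp ⊢
  obtain ⟨⟨h1, h2, h12⟩, rfl, rfl⟩ := hp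
  exact ⟨h1, h2, h12, rfl⟩

theorem label_eq_of_even_add {u v : V} (huv : (labelGraph G h a b).Adj u v)
    (hpar : Even (h u) ↔ ¬ Even (h v)) (ha : Even (h u + a)) : h u = a := by
  rcases Sym2.eq_iff.1 huv.2 with ⟨hu, -⟩ | ⟨hu, hv⟩
  · exact hu
  · rw [← hv, Nat.even_add] at ha
    tauto

theorem exists_label_core [DecidableRel G.Adj] {Z : Finset V} {k : ℕ} (hk : 0 < k)
    (hi : ∀ v ∈ Z, h v ≤ i)
    (hpar : ∀ u ∈ Z, ∀ v ∈ Z, G.Adj u v → (Even (h u) ↔ ¬ Even (h v)))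
    (hZ : (i + 1) * (i + 1) * (2 * k * #Z) < #(G.interedges Z Z)) :
    ∃ S ⊆ Z, ∃ a ≤ i, S.Nonempty ∧ (∀ v ∈ S, Even (h v + a) → h v = a) ∧
      ∀ x ∈ S, ∀ l ≤ k, ∃ y ∈ S, ∃ p : G.Walk y x, p.IsPath ∧ p.length = l ∧
        ∀ v ∈ p.support, v ∈ S := by
  obtain ⟨a, b, hdense⟩ := exists_dense_labelGraph hi hZ
  obtain ⟨S, hSZ, ⟨x, hx⟩, hcore⟩ := exists_subset_forall_le_degree _ hdense
  have hnbr {v : V} (hv : v ∈ S) : ∃ w ∈ S, (labelGraph G h a b).Adj v w := by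
    have hpos := card_pos.1 (hk.trans_le (hcore v hv))
    simpa [Finset.Nonempty] using hpos
  have ha : a ≤ i := by
    obtain ⟨w, hw, hxw⟩ := hnbr hx
    rcases Sym2.eq_iff.1 hxw.2 with hl | hl
    · exact hl.1 ▸ hi x (hSZ hx)
    · exact hl.2 ▸ hi w (hSZ hw)
  refine ⟨S, hSZ, a, ha, ⟨x, hx⟩, fun v hv heven => ?_, fun x hx l hl => ?_⟩
  · obtain ⟨w, hw, hvw⟩ := hnbr hv
    exact label_eq_of_even_add hvw (hpar v (hSZ hv) w (hSZ hw) hvw.1) heven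
  · obtain ⟨y, hy, p, hp, hpl, hpS⟩ := exists_isPath_of_forall_le_degree _ hcore hx hl
    have hle : labelGraph G h a b ≤ G := fun _ _ huv => huv.1
    exact ⟨y, hy, p.mapLe hle, by simpa using hp, by simpa using hpl, by simpa using hpS⟩

end Labels

/-- Label each vertex of `Z` with the length of a path to `A`. Paths between vertices of the core of
a popular pair of labels have ends whose labels are known up to parity, and the bipartition settles
the parity. -/
theorem exists_isPath_of_reach [DecidableRel G.Adj] (C : G.Coloring Bool) (β : Bool)
    {A B UA UB Z : Finset V} {i k T : ℕ} (hA : ∀ v ∈ A, C v = β) (hB : ∀ v ∈ B, C v = β)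
    (hUU : Disjoint UA UB) (hZA : Disjoint Z UA) (hZB : Disjoint Z UB)
    (hrA : ∀ v ∈ Z, Reach G A UA i v) (hrB : ∀ v ∈ Z, Reach G B UB i v)
    (hZ : (i + 1) * (i + 1) * (2 * k * #Z) < #(G.interedges Z Z))
    (hT : Even T) (hiT : 2 * i ≤ T) (hTk : T < k) :
    ∃ a ∈ A, ∃ b ∈ B, ∃ p : G.Walk a b, p.IsPath ∧ p.length = T ∧
      ∀ z ∈ p.support, z ∈ UA ∨ z ∈ Z ∨ z ∈ UB := by
  classical
  choose! h hi hpath using fun v hv =>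
    show ∃ l, l ≤ i ∧ ∃ a ∈ A, ∃ p : G.Walk v a, p.IsPath ∧ p.length = l ∧
        ∀ z ∈ p.support, z = v ∨ z ∈ UA by
      obtain ⟨a, ha, p, hp, hpi, hpU⟩ := (hrA v hv).exists_isPath
      exact ⟨p.length, hpi, a, ha, p, hp, rfl, hpU⟩
  have heven {v : V} (hv : v ∈ Z) : Even (h v) ↔ (C v ↔ β) := by
    obtain ⟨a, ha, p, -, hpl, -⟩ := hpath v hv
    rw [← hpl, C.even_length_iff_congr p, hA a ha]
  have hpar (u) (hu : u ∈ Z) (v) (hv : v ∈ Z) (huv : G.Adj u v) :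
      Even (h u) ↔ ¬ Even (h v) := by
    have hC := C.valid huv
    rw [heven hu, heven hv]
    revert hC
    cases C u <;> cases C v <;> cases β <;> simp
  obtain ⟨S, hSZ, l, hl, ⟨x, hx⟩, hlabel, hpaths⟩ := exists_label_core hTk.pos hi hpar hZ
  obtain ⟨b, hb, q, hq, hqi, hqU⟩ := (hrB x (hSZ hx)).exists_isPath
  obtain ⟨y, hy, z, hz, hzl, hzS⟩ := hpaths x hx (T - q.length - l) (by omega)
  obtain ⟨a, ha, p, hp, hpl, hpU⟩ := hpath y (hSZ hy)
  have hlen : (p.reverse.append (z.append q)).length = h y + (T - l) := by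
    simp only [Walk.length_append, Walk.length_reverse, hpl, hzl]
    omega
  have hyl : h y = l := by
    have heven_walk := C.even_length_iff_congr (p.reverse.append (z.append q))
    rw [hA a ha, hB b hb, hlen, Nat.even_add, Nat.even_sub (by omega)] at heven_walk
    refine hlabel y hy ?_
    rw [Nat.even_add]
    tauto
  refine ⟨a, ha, b, hb, p.reverse.append (z.append q), isPath_reverse_append_append hUU hZA hZB hp
    hpU hz (fun v hv => hSZ (hzS v hv)) hq hqU, by omega, fun v hv => ?_⟩
  rw [Walk.mem_support_append_iff, Walk.mem_support_append_iff, Walk.support_reverse,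
    List.mem_reverse] at hv
  have hxZ := hSZ hx
  have hyZ := hSZ hy
  grind

end ExactLength

/-- The relations between the numbers of vertices `n`, the minimum degree `d` and the length scale
`m` under which the construction works. The exponents are generous. -/
structure Regime (n d m : ℕ) : Prop where
  le_m : 1000 ≤ m
  pow_le_d : m ^ 200 ≤ d
  mul_pow_le_n : d * m ^ 250 ≤ n

namespace Regime

variable {n d m : ℕ}

theorem m_pos (h : Regime n d m) : 0 < m := by
  have := h.le_m
  omega

theorem pow_le (h : Regime n d m) {j : ℕ} (hj : j ≤ 200) : m ^ j ≤ d :=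
  (Nat.pow_le_pow_right h.m_pos hj).trans h.pow_le_d

theorem d_pos (h : Regime n d m) : 0 < d :=
  (pow_pos h.m_pos 200).trans_le h.pow_le_d

theorem mul_pow_le (h : Regime n d m) {j : ℕ} (hj : j ≤ 250) : d * m ^ j ≤ n :=
  (Nat.mul_le_mul_left d (Nat.pow_le_pow_right h.m_pos hj)).trans h.mul_pow_le_n

theorem thousand_mul_pow_le (h : Regime n d m) {i j : ℕ} (hij : i < j) :
    1000 * m ^ i ≤ m ^ j :=
  calc 1000 * m ^ i ≤ m * m ^ i := Nat.mul_le_mul_right _ h.le_m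
    _ = m ^ (i + 1) := (pow_succ' m i).symm
    _ ≤ m ^ j := Nat.pow_le_pow_right h.m_pos hij

theorem thousand_mul_mul_pow_le (h : Regime n d m) (c : ℕ) {i j : ℕ} (hij : i < j) :
    1000 * (c * m ^ i) ≤ c * m ^ j := by
  rw [mul_left_comm]
  exact Nat.mul_le_mul_left c (h.thousand_mul_pow_le hij)

theorem thousand_mul_le_div (h : Regime n d m) : 1000 * d ≤ n / m ^ 2 := by
  rw [Nat.le_div_iff_mul_le (pow_pos h.m_pos 2), mul_assoc]
  exact (h.thousand_mul_mul_pow_le d (by norm_num : 2 < 3)).trans (h.mul_pow_le (by norm_num))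

theorem mul_le_mul_div (h : Regime n d m) {e : ℕ} (he : e ≤ m) :
    e * m ^ 6 * n ≤ d * (n / m ^ 2) := by
  have hn : n ≤ 2 * (m ^ 2 * (n / m ^ 2)) := by
    have := Nat.lt_mul_div_succ n (pow_pos h.m_pos 2)
    have : m ^ 2 * 1 ≤ m ^ 2 * (n / m ^ 2) :=
      Nat.mul_le_mul_left _ (by have := h.thousand_mul_le_div; have := h.d_pos; omega)
    rw [Nat.mul_add] at *
    omega
  calc e * m ^ 6 * n ≤ m * m ^ 6 * (2 * (m ^ 2 * (n / m ^ 2))) := by gcongr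
    _ = 2 * m ^ 9 * (n / m ^ 2) := by ring
    _ ≤ d * (n / m ^ 2) := by
      have := h.thousand_mul_pow_le (by norm_num : 9 < 10)
      have := h.pow_le (by norm_num : 10 ≤ 200)
      gcongr
      omega

theorem mul_lt_div (h : Regime n d m) {e w : ℕ} (he : e ≤ m) (hw : m ^ 4 * w ≤ 2 * n) :
    2 * e * w < n / m ^ 2 := by
  rw [Nat.lt_iff_add_one_le, Nat.le_div_iff_mul_le (pow_pos h.m_pos 2)]
  have hm2 : m ^ 2 ≤ d * m ^ 2 := Nat.le_mul_of_pos_left _ h.d_pos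
  have hdm : 1000 * (d * m ^ 2) ≤ n :=
    (h.thousand_mul_mul_pow_le d (by norm_num : 2 < 3)).trans (h.mul_pow_le (by norm_num))
  have hmw : 1000 * (w * m ^ 3) ≤ 2 * n :=
    (h.thousand_mul_mul_pow_le w (by norm_num : 3 < 4)).trans (by rwa [mul_comm])
  have hew : e * w * m ^ 2 ≤ w * m ^ 3 :=
    calc e * w * m ^ 2 ≤ m * w * m ^ 2 := by gcongr
      _ = w * m ^ 3 := by ring
  calc (2 * e * w + 1) * m ^ 2 = 2 * (e * w * m ^ 2) + m ^ 2 := by ring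
    _ ≤ n := by omega

theorem pow_four_mul_le (h : Regime n d m) {r u : ℕ} (hr : 4 * r ≤ m)
    (hu : m ^ 6 * u ≤ 2 * r * n) : m ^ 4 * u ≤ n := by
  have hm5 : m * (m ^ 5 * u) ≤ m * n :=
    calc m * (m ^ 5 * u) = m ^ 6 * u := by ring
      _ ≤ 2 * r * n := hu
      _ ≤ m * n := by gcongr; omega
  exact (Nat.mul_le_mul_right _ (Nat.pow_le_pow_right h.m_pos (by norm_num))).trans
    (Nat.le_of_mul_le_mul_left hm5 h.m_pos)

theorem two_mul_pow_mul_lt (h : Regime n d m) {e r : ℕ}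
    (hrounds : n * (4 * e) ^ r ≤ d * (4 * e + 1) ^ r) :
    (2 * e) ^ r * n < (2 * e + 1) ^ r * (n / m ^ 2) := by
  have hd : (2 * e) ^ r * n ≤ (2 * e + 1) ^ r * d := by
    refine Nat.le_of_mul_le_mul_left (c := 2 ^ r) ?_ (by positivity)
    calc 2 ^ r * ((2 * e) ^ r * n) = n * (4 * e) ^ r := by
          rw [← mul_assoc, ← mul_pow]; ring_nf
      _ ≤ d * (4 * e + 1) ^ r := hrounds
      _ ≤ d * (2 * (2 * e + 1)) ^ r := by gcongr; omega
      _ = 2 ^ r * ((2 * e + 1) ^ r * d) := by rw [mul_pow]; ring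
  have hdiv := h.thousand_mul_le_div
  have := h.d_pos
  exact hd.trans_lt (Nat.mul_lt_mul_of_pos_left (by omega) (by positivity))

end Regime

section Connect

variable {V : Type*} [Fintype V] {G : SimpleGraph V}

/-- Two large sets in the colour class `β` are joined by a path of any prescribed even length
between `m` and `m ^ 4`, which avoids a forbidden set `W`. -/
def JoinsLargeSets (C : G.Coloring Bool) (d m : ℕ) : Prop :=
  ∀ ⦃β : Bool⦄ ⦃A B W : Finset V⦄ ⦃T : ℕ⦄, (∀ v ∈ A, C v = β) → (∀ v ∈ B, C v = β) →
    2 * d + #W * (m ^ 4 + 1) ≤ #A → 2 * d + #W * (m ^ 4 + 1) ≤ #B → Even T → m ≤ T → T < m ^ 4 →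
    ∃ a ∈ A, ∃ b ∈ B, ∃ p : G.Walk a b, p.IsPath ∧ p.length = T ∧ ∀ z ∈ p.support, z ∉ W

namespace EdgeExpanding

variable [DecidableEq V] [DecidableRel G.Adj] {d e m r : ℕ}

theorem exists_common_reach_of_regime (hG : EdgeExpanding G d e)
    (hreg : Regime (Fintype.card V) d m) (he : 0 < e) (hem : e ≤ m) (hrm : 4 * r ≤ m)
    (hrounds : Fintype.card V * (4 * e) ^ r ≤ d * (4 * e + 1) ^ r) {A B W : Finset V}
    (hdA : 2 * d ≤ #A) (hdB : 2 * d ≤ #B) (hWA : #W * m ^ 4 ≤ #A) (hWB : #W * m ^ 4 ≤ #B) :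
    ∃ UA UB Z, Disjoint UA (W ∪ UB) ∧ Disjoint UB (W ∪ UA) ∧ Disjoint Z (W ∪ UA ∪ UB) ∧
      (∀ v ∈ Z, Reach G A UA (2 * r) v) ∧ (∀ v ∈ Z, Reach G B UB (2 * r) v) ∧
      m ^ 2 * #Zᶜ ≤ 5 * Fintype.card V := by
  have hm := hreg.le_m
  have hm13 := hreg.thousand_mul_pow_le (by norm_num : 1 < 3)
  have hm34 := hreg.thousand_mul_pow_le (by norm_num : 3 < 4)
  have hm46 := hreg.thousand_mul_pow_le (by norm_num : 4 < 6)
  have hm67 := hreg.thousand_mul_pow_le (by norm_num : 6 < 7)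
  have hm7d := hreg.pow_le (by norm_num : 7 ≤ 200)
  rw [pow_one] at hm13
  have hWn : m ^ 4 * #W ≤ Fintype.card V := by
    rw [mul_comm]
    exact hWA.trans (card_le_univ A)
  have hMe : m ^ 6 * e ≤ d := (Nat.mul_le_mul_left _ hem).trans (by rwa [← pow_succ])
  have hrM : 2 * (4 * e + 2) * r ≤ m ^ 6 :=
    calc 2 * (4 * e + 2) * r ≤ m ^ 4 * m ^ 2 := by
          gcongr
          · omega
          · nlinarith
      _ = m ^ 6 := by ring
  have hsmall : ∀ U : Finset V, m ^ 6 * #U ≤ 2 * r * Fintype.card V →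
      2 * e * #(W ∪ U) < Fintype.card V / m ^ 2 := fun U hU =>
    hreg.mul_lt_div hem <| by
      have := hreg.pow_four_mul_le hrm hU
      have := Nat.mul_le_mul_left (m ^ 4) (card_union_le W U)
      rw [Nat.mul_add] at this
      omega
  obtain ⟨UA, UB, Z, hUA, hUB, hZ, hrA, hrB, hcA, hcB, hcZ⟩ :=
    hG.exists_common_reach (pow_pos hreg.m_pos 6) he hMe (min_le_left #A #B) (min_le_right #A #B)
      (W := W) (le_min hdA hdB) (by omega)
      ((Nat.mul_le_mul_right _ (by omega)).trans ((mul_comm _ _).le.trans (le_min hWA hWB))) hrM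
      hrounds (by have := hreg.thousand_mul_le_div; omega)
      (hreg.mul_le_mul_div hem) (hreg.two_mul_pow_mul_lt hrounds) hsmall
  refine ⟨UA, UB, Z, hUA, hUB, hZ, hrA, hrB, ?_⟩
  have hpow {u : ℕ} (hu : m ^ 4 * u ≤ Fintype.card V) : m ^ 2 * u ≤ Fintype.card V :=
    (Nat.mul_le_mul_right _ (Nat.pow_le_pow_right hreg.m_pos (by norm_num))).trans hu
  have := hpow hWn
  have := hpow (hreg.pow_four_mul_le hrm hcA)
  have := hpow (hreg.pow_four_mul_le hrm hcB)
  have := Nat.mul_div_le (Fintype.card V) (m ^ 2)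
  have := Nat.mul_le_mul_left (m ^ 2) hcZ
  linarith

theorem lt_card_interedges_of_regime (hG : EdgeExpanding G d e)
    (hreg : Regime (Fintype.card V) d m) (he : 0 < e) (hem : e ≤ m) (hrm : 4 * r ≤ m) {Z : Finset V}
    (hZ : m ^ 2 * #Zᶜ ≤ 5 * Fintype.card V) :
    (2 * r + 1) * (2 * r + 1) * (2 * m ^ 4 * #Z) < #(G.interedges Z Z) := by
  have hm := hreg.le_m
  have heZ : 200 * (e * #Zᶜ) ≤ Fintype.card V := by
    have : 1000 * (e * #Zᶜ) ≤ m ^ 2 * #Zᶜ := by rw [← mul_assoc]; gcongr; nlinarith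
    omega
  have hZe : #Zᶜ ≤ e * #Zᶜ := Nat.le_mul_of_pos_left _ he
  have hZcard : #Z + #Zᶜ = Fintype.card V := card_add_card_compl Z
  have hdn : 1000 * d ≤ Fintype.card V := hreg.thousand_mul_le_div.trans (Nat.div_le_self _ _)
  have := hreg.d_pos
  obtain ⟨X, hXZ, hX⟩ := exists_subset_card_eq (show Fintype.card V / 3 ≤ #Z by omega)
  have hedges : d * #X < e * #(G.interedges X (Z \ X)) :=
    hG X (Z \ X) disjoint_sdiff (by omega) (by omega)
      (by rw [union_sdiff_of_subset hXZ]; omega)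
  refine Nat.lt_of_mul_lt_mul_left (a := e) ?_
  calc e * ((2 * r + 1) * (2 * r + 1) * (2 * m ^ 4 * #Z))
      ≤ m * (m * m * (2 * m ^ 4 * (4 * #X))) := by gcongr <;> omega
    _ = 8 * m ^ 7 * #X := by ring
    _ ≤ d * #X := by
      have := hreg.thousand_mul_pow_le (by norm_num : 7 < 8)
      have := hreg.pow_le (by norm_num : 8 ≤ 200)
      gcongr
      omega
    _ < e * #(G.interedges X (Z \ X)) := hedges
    _ ≤ e * #(G.interedges Z Z) := by
      gcongr
      exact Rel.interedges_mono hXZ sdiff_subset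

theorem joinsLargeSets (hG : EdgeExpanding G d e) (hreg : Regime (Fintype.card V) d m)
    (he : 0 < e) (hem : e ≤ m) (hrm : 4 * r ≤ m)
    (hrounds : Fintype.card V * (4 * e) ^ r ≤ d * (4 * e + 1) ^ r) (C : G.Coloring Bool) :
    JoinsLargeSets C d m := by
  intro β A B W T hA hB hWA hWB hT hmT hTm
  rw [Nat.mul_add, mul_one] at hWA hWB
  obtain ⟨UA, UB, Z, hUA, hUB, hZ, hrA, hrB, hcZ⟩ :=
    hG.exists_common_reach_of_regime hreg he hem hrm hrounds (A := A \ W) (B := B \ W) (W := W)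
      (by have := le_card_sdiff W A; omega) (by have := le_card_sdiff W B; omega)
      (by have := le_card_sdiff W A; omega) (by have := le_card_sdiff W B; omega)
  simp only [disjoint_union_right] at hUA hUB hZ
  obtain ⟨a, ha, b, hb, p, hp, hpl, hpU⟩ := exists_isPath_of_reach C β
    (fun v hv => hA v (mem_sdiff.1 hv).1) (fun v hv => hB v (mem_sdiff.1 hv).1)
    hUA.2 hZ.1.2 hZ.2 hrA hrB (hG.lt_card_interedges_of_regime hreg he hem hrm hcZ)
    hT (by omega) hTm
  refine ⟨a, (mem_sdiff.1 ha).1, b, (mem_sdiff.1 hb).1, p, hp, hpl, fun z hz => ?_⟩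
  rcases hpU z hz with h | h | h
  · exact Finset.disjoint_left.1 hUA.1 h
  · exact Finset.disjoint_left.1 hZ.1.1 h
  · exact Finset.disjoint_left.1 hUB.1 h

end EdgeExpanding

end Connect

section DependentRandomChoice

variable {α β : Type*}

theorem sum_card_filter_forall {γ : Type*} (X : Finset α) (B : Finset γ) (S : α → γ → Prop)
    [∀ x b, Decidable (S x b)] (r : ℕ) :
    ∑ f ∈ Fintype.piFinset fun _ : Fin r => X, #{b ∈ B | ∀ i, S (f i) b} =
      ∑ b ∈ B, #{x ∈ X | S x b} ^ r := by
  classical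
  calc ∑ f ∈ Fintype.piFinset fun _ : Fin r => X, #{b ∈ B | ∀ i, S (f i) b}
      = ∑ b ∈ B, #{f ∈ Fintype.piFinset fun _ : Fin r => X | ∀ i, S (f i) b} :=
        sum_card_bipartiteAbove_eq_sum_card_bipartiteBelow
          fun (f : Fin r → α) b => ∀ i, S (f i) b
    _ = ∑ b ∈ B, #(Fintype.piFinset fun _ : Fin r => {x ∈ X | S x b}) := by
        congr! 3 with b
        ext f
        simp only [mem_filter, Fintype.mem_piFinset, forall_and]
    _ = ∑ b ∈ B, #{x ∈ X | S x b} ^ r := by simp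

theorem exists_subset_forall_not_of_card_le (A : Finset β) (P : β → β → Prop)
    [∀ u v, Decidable (P u v)] {t : ℕ} (h : t + #{p ∈ A ×ˢ A | P p.1 p.2} ≤ #A) :
    ∃ T ⊆ A, #T = t ∧ ∀ u ∈ T, ∀ v ∈ T, ¬ P u v := by
  classical
  set B := ({p ∈ A ×ˢ A | P p.1 p.2}).image Prod.fst
  have hcard : t ≤ #(A \ B) := by
    have := le_card_sdiff B A
    have : #B ≤ _ := card_image_le
    omega
  obtain ⟨T, hTA, hT⟩ := exists_subset_card_eq hcard
  refine ⟨T, hTA.trans sdiff_subset, hT, fun u hu v hv huv => (mem_sdiff.1 (hTA hu)).2 ?_⟩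
  exact mem_image.2 ⟨(u, v), mem_filter.2 ⟨mem_product.2
    ⟨(mem_sdiff.1 (hTA hu)).1, (mem_sdiff.1 (hTA hv)).1⟩, huv⟩, rfl⟩

theorem exists_add_le_of_sum_le {γ : Type*} {s : Finset γ} {f g : γ → ℕ} {u y t : ℕ} (hu : 0 < u)
    (hs : s.Nonempty) (hf : u * #s ≤ y * ∑ i ∈ s, f i)
    (hg : y ^ 10 * ∑ i ∈ s, g i ≤ u ^ 2 * #s) (huy : 2 * u ≤ y ^ 9) (ht : 2 * t * y ≤ u) :
    ∃ i ∈ s, t + g i ≤ f i := by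
  by_contra! hlt
  have hsum : ∑ i ∈ s, f i < #s * t + ∑ i ∈ s, g i := by
    simpa only [sum_add_distrib, sum_const, smul_eq_mul] using sum_lt_sum_of_nonempty hs hlt
  have hy : 0 < y := Nat.pos_of_ne_zero fun h => by simp [h] at huy; omega
  have hyg : 2 * y * ∑ i ∈ s, g i ≤ u * #s := by
    refine Nat.le_of_mul_le_mul_left ?_ hu
    calc u * (2 * y * ∑ i ∈ s, g i) = 2 * u * (y * ∑ i ∈ s, g i) := by ring
      _ ≤ y ^ 9 * (y * ∑ i ∈ s, g i) := Nat.mul_le_mul_right _ huy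
      _ = y ^ 10 * ∑ i ∈ s, g i := by ring
      _ ≤ u ^ 2 * #s := hg
      _ = u * (u * #s) := by ring
  have hyt : 2 * t * y * #s ≤ u * #s := Nat.mul_le_mul_right _ ht
  have := Nat.mul_lt_mul_of_pos_left hsum hy
  nlinarith

variable (R : α → β → Prop) [∀ x u, Decidable (R x u)] {X : Finset α} {U : Finset β} {c τ : ℕ}

theorem card_mul_card_pow_le_sum (hdeg : ∀ x ∈ X, #U ≤ c * #{u ∈ U | R x u}) (hU : U.Nonempty)
    (q : ℕ) :
    #U * #X ^ (q + 1) ≤ c ^ (q + 1) *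
      ∑ f ∈ Fintype.piFinset fun _ : Fin (q + 1) => X, #{u ∈ U | ∀ i, R (f i) u} := by
  rw [sum_card_filter_forall]
  have hedges : #X * #U ≤ c * ∑ u ∈ U, #{x ∈ X | R x u} :=
    calc #X * #U ≤ ∑ x ∈ X, c * #{u ∈ U | R x u} := by
          rw [← smul_eq_mul, ← sum_const]
          exact sum_le_sum hdeg
      _ = c * ∑ u ∈ U, #{x ∈ X | R x u} := by
          rw [← mul_sum]
          exact congrArg _ (sum_card_bipartiteAbove_eq_sum_card_bipartiteBelow R)
  refine Nat.le_of_mul_le_mul_left (c := #U ^ q) ?_ (pow_pos (card_pos.2 hU) q)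
  calc #U ^ q * (#U * #X ^ (q + 1)) = (#X * #U) ^ (q + 1) := by ring
    _ ≤ (c * ∑ u ∈ U, #{x ∈ X | R x u}) ^ (q + 1) := Nat.pow_le_pow_left hedges _
    _ = c ^ (q + 1) * (∑ u ∈ U, #{x ∈ X | R x u}) ^ (q + 1) := mul_pow _ _ _
    _ ≤ c ^ (q + 1) * (#U ^ q * ∑ u ∈ U, #{x ∈ X | R x u} ^ (q + 1)) := by
        gcongr
        exact pow_sum_le_card_mul_sum_pow (fun _ _ => Nat.zero_le _) q
    _ = #U ^ q * (c ^ (q + 1) * ∑ u ∈ U, #{x ∈ X | R x u} ^ (q + 1)) := by ring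

theorem mul_sum_card_pairs_le (hτ : τ * c ^ 10 ≤ #X) (U : Finset β) (r : ℕ) :
    (c ^ r) ^ 10 * ∑ f ∈ Fintype.piFinset fun _ : Fin r => X,
        #{p ∈ ({u ∈ U | ∀ i, R (f i) u} ×ˢ {u ∈ U | ∀ i, R (f i) u}) |
          #{x ∈ X | R x p.1 ∧ R x p.2} < τ} ≤
      #U ^ 2 * #X ^ r := by
  set bad : Finset (β × β) := {p ∈ U ×ˢ U | #{x ∈ X | R x p.1 ∧ R x p.2} < τ} with hbad
  have hpairs : ∀ f : Fin r → α,
      {p ∈ ({u ∈ U | ∀ i, R (f i) u} ×ˢ {u ∈ U | ∀ i, R (f i) u}) |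
        #{x ∈ X | R x p.1 ∧ R x p.2} < τ} =
      {p ∈ bad | ∀ i, R (f i) p.1 ∧ R (f i) p.2} := fun f => by
    ext p
    simp only [hbad, mem_filter, mem_product, forall_and]
    tauto
  simp only [hpairs]
  rw [sum_card_filter_forall X bad fun x p => R x p.1 ∧ R x p.2]
  calc (c ^ r) ^ 10 * ∑ p ∈ bad, #{x ∈ X | R x p.1 ∧ R x p.2} ^ r
      ≤ (c ^ r) ^ 10 * ∑ _p ∈ bad, τ ^ r := by
        gcongr with _ hp
        exact (mem_filter.1 hp).2.le
    _ = #bad * (τ * c ^ 10) ^ r := by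
        rw [sum_const, smul_eq_mul]; ring
    _ ≤ #U ^ 2 * #X ^ r := by
        gcongr
        exact (card_filter_le _ _).trans (by rw [card_product, pow_two])

/-- Sample a random `r`-tuple from `X` and keep the elements of `U` related to all its entries. A
pair with few common neighbours survives with probability at most `c ^ (-10 r)`, whereas a single
element survives with probability at least `c ^ (-r)` on average. -/
theorem exists_subset_forall_le_codegree {t : ℕ} (hc : 2 ≤ c) (hX : X.Nonempty) (hU : U.Nonempty)
    (hdeg : ∀ x ∈ X, #U ≤ c * #{u ∈ U | R x u}) (hτ : τ * c ^ 10 ≤ #X)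
    (ht : 2 * (2 * t) ^ 9 * c ^ 9 ≤ #U ^ 8) :
    ∃ T ⊆ U, #T = t ∧ ∀ u ∈ T, ∀ v ∈ T, τ ≤ #{x ∈ X | R x u ∧ R x v} := by
  have hUpos := card_pos.2 hU
  obtain ⟨q, hq, hq'⟩ := exists_nat_pow_near (show 1 ≤ 2 * #U by omega)
    (Nat.one_lt_pow (by norm_num) (by omega : 1 < c) : 1 < c ^ 9)
  have htq : 2 * t * c ^ (q + 1) ≤ #U := by
    refine (Nat.pow_le_pow_iff_left (n := 9) (by norm_num)).1 ?_
    calc (2 * t * c ^ (q + 1)) ^ 9 = (2 * t) ^ 9 * c ^ 9 * (c ^ 9) ^ q := by ring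
      _ ≤ (2 * t) ^ 9 * c ^ 9 * (2 * #U) := Nat.mul_le_mul_left _ hq
      _ = (2 * (2 * t) ^ 9 * c ^ 9) * #U := by ring
      _ ≤ #U ^ 8 * #U := Nat.mul_le_mul_right _ ht
      _ = #U ^ 9 := by ring
  have htuples : #(Fintype.piFinset fun _ : Fin (q + 1) => X) = #X ^ (q + 1) := by simp
  obtain ⟨f, -, hf⟩ := exists_add_le_of_sum_le hUpos (Fintype.piFinset_nonempty.2 fun _ => hX)
    (htuples ▸ card_mul_card_pow_le_sum R hdeg hU q)
    (htuples ▸ mul_sum_card_pairs_le R hτ U (q + 1))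
    (by rw [pow_right_comm]; exact hq'.le) htq
  obtain ⟨T, hTA, hTt, hT⟩ := exists_subset_forall_not_of_card_le _
    (fun u v => #{x ∈ X | R x u ∧ R x v} < τ) hf
  exact ⟨T, hTA.trans (filter_subset _ _), hTt, fun u hu v hv => not_lt.1 (hT u hu v hv)⟩

end DependentRandomChoice

/-- Hall's theorem selects distinct midpoints for the pairs of branch vertices. -/
theorem containsTK_one_of_le_codegree {V : Type*} {G : SimpleGraph V} [DecidableRel G.Adj]
    {X T : Finset V} {t : ℕ} (hXT : Disjoint X T) (hT : #T = t)
    (hcodeg : ∀ u ∈ T, ∀ v ∈ T, u ≠ v → t * t ≤ #{x ∈ X | G.Adj x u ∧ G.Adj x v}) :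
    ContainsTK G t 1 := by
  classical
  let c : Fin t ↪ V :=
    (T.equivFinOfCardEq hT).symm.toEmbedding.trans (Function.Embedding.subtype _)
  have hcT : ∀ i, c i ∈ T := fun i => ((T.equivFinOfCardEq hT).symm i).2
  let mids (p : {p : Fin t × Fin t // p.1 < p.2}) : Finset V :=
    {x ∈ X | G.Adj x (c p.1.1) ∧ G.Adj x (c p.1.2)}
  have hhall (s : Finset {p : Fin t × Fin t // p.1 < p.2}) : #s ≤ #(s.biUnion mids) := by
    rcases s.eq_empty_or_nonempty with rfl | ⟨p, hp⟩
    · simp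
    calc #s ≤ t * t := (card_le_univ s).trans ((Fintype.card_subtype_le _).trans (by simp))
      _ ≤ #(mids p) := hcodeg _ (hcT _) _ (hcT _) (c.injective.ne p.2.ne)
      _ ≤ #(s.biUnion mids) := card_le_card (subset_biUnion_of_mem mids hp)
  obtain ⟨mid, hmid, hmids⟩ := (all_card_le_biUnion_card_iff_exists_injective mids).1 hhall
  have hadj p : G.Adj (mid p) (c p.1.1) ∧ G.Adj (mid p) (c p.1.2) := (mem_filter.1 (hmids p)).2
  have hmid_ne p i : mid p ≠ c i := fun h =>
    Finset.disjoint_left.1 hXT (mem_filter.1 (hmids p)).1 (h ▸ hcT i)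
  refine ⟨c, fun i j hij => .cons (hadj ⟨(i, j), hij⟩).1.symm (.cons (hadj ⟨(i, j), hij⟩).2 .nil),
    fun i j hij => ⟨?_, by simp⟩, fun i j hij k hk => ?_,
    fun i j hij i' j' hij' hne v hv hvi hvj hv' => ?_⟩
  · rw [Walk.isPath_def]
    simp [c.injective.ne hij.ne, hmid_ne, (hmid_ne _ _).symm]
  · simpa [(hmid_ne _ _).symm] using hk
  · obtain rfl : v = mid ⟨(i, j), hij⟩ := by simpa [hvi, hvj] using hv
    have hmid_eq : mid ⟨(i, j), hij⟩ = mid ⟨(i', j'), hij'⟩ := by simpa [hmid_ne] using hv'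
    exact hne (Subtype.ext_iff.1 (hmid hmid_eq))

section Greedy

variable {ι V : Type*} {α : ι → Type*} {P : ∀ i, α i → Prop} {foot : ∀ i, α i → Finset V}

theorem exists_pairwise_disjoint_of_extend [Finite ι]
    (h : ∀ (s : Finset ι) (f : ∀ i : s, α i), (∀ i : s, P i (f i)) → ∀ q ∉ s,
      ∃ x, P q x ∧ ∀ i : s, Disjoint (foot q x) (foot i (f i))) :
    ∃ f : ∀ i, α i, (∀ i, P i (f i)) ∧
      Pairwise fun i j => Disjoint (foot i (f i)) (foot j (f j)) := by
  classical
  cases nonempty_fintype ι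
  suffices hpartial : ∀ s : Finset ι, ∃ f : ∀ i : s, α i, (∀ i : s, P i (f i)) ∧
      ∀ i j : s, i ≠ j → Disjoint (foot i (f i)) (foot j (f j)) by
    obtain ⟨f, hfP, hfd⟩ := hpartial univ
    exact ⟨fun i => f ⟨i, mem_univ i⟩, fun i => hfP ⟨i, mem_univ i⟩,
      fun i j hij => hfd ⟨i, mem_univ i⟩ ⟨j, mem_univ j⟩ (by simpa using hij)⟩
  intro s
  induction s using Finset.induction with
  | empty => exact ⟨fun i => absurd i.2 (notMem_empty _), fun i => absurd i.2 (notMem_empty _),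
      fun i => absurd i.2 (notMem_empty _)⟩
  | insert q s hq ih =>
    obtain ⟨f, hfP, hfd⟩ := ih
    obtain ⟨x, hxP, hxd⟩ := h s f hfP q hq
    obtain ⟨g, hgq, hgs⟩ : ∃ g : ∀ i : ↥(insert q s), α i, g ⟨q, mem_insert_self q s⟩ = x ∧
        ∀ i : s, g ⟨i, mem_insert_of_mem i.2⟩ = f i :=
      ⟨fun i => if hi : i.1 = q then cast (congrArg α hi.symm) x else
        f ⟨i, (mem_insert.1 i.2).resolve_left hi⟩, by simp,
        fun i => dif_neg fun hi : i.1 = q => hq (hi ▸ i.2)⟩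
    refine ⟨g, ?_, ?_⟩
    · rintro ⟨i, hi⟩
      obtain rfl | his := mem_insert.1 hi
      · rwa [hgq]
      · rw [hgs ⟨i, his⟩]
        exact hfP ⟨i, his⟩
    · rintro ⟨i, hi⟩ ⟨j, hj⟩ hij
      obtain rfl | his := mem_insert.1 hi <;> obtain rfl | hjs := mem_insert.1 hj
      · exact absurd rfl hij
      · rw [hgq, hgs ⟨j, hjs⟩]
        exact hxd ⟨j, hjs⟩
      · rw [hgq, hgs ⟨i, his⟩]
        exact (hxd ⟨i, his⟩).symm
      · rw [hgs ⟨i, his⟩, hgs ⟨j, hjs⟩]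
        exact hfd ⟨i, his⟩ ⟨j, hjs⟩ (by simpa using hij)

theorem exists_pairwise_disjoint_of_avoid [Fintype ι] {c : ℕ}
    (hfoot : ∀ i x, P i x → #(foot i x) ≤ c)
    (havoid : ∀ i, ∀ U : Finset V, #U ≤ Fintype.card ι * c → ∃ x, P i x ∧ Disjoint (foot i x) U) :
    ∃ f : ∀ i, α i, (∀ i, P i (f i)) ∧
      Pairwise fun i j => Disjoint (foot i (f i)) (foot j (f j)) := by
  classical
  refine exists_pairwise_disjoint_of_extend fun s f hf q _ => ?_
  set U : Finset V := (univ : Finset s).biUnion fun i => foot i (f i)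
  have hU : #U ≤ Fintype.card ι * c :=
    (card_biUnion_le_card_mul _ _ c fun (i : s) _ => hfoot i _ (hf i)).trans
      (Nat.mul_le_mul_right c (by simpa using card_le_univ s))
  obtain ⟨x, hxP, hx⟩ := havoid q U hU
  exact ⟨x, hxP, fun i => (Finset.disjoint_biUnion_right _ _ _).1 hx i (mem_univ i)⟩

end Greedy

section Star

variable {V : Type*} {G : SimpleGraph V}

/-- A star with exactly `k` leaves, from which the hubs are built. -/
structure Star (G : SimpleGraph V) (k : ℕ) where
  centre : V
  leaves : Finset V
  adj : ∀ v ∈ leaves, G.Adj centre v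
  card_leaves : #leaves = k

namespace Star

variable [DecidableEq V] {k : ℕ}

/-- The vertex set of a star; families of stars are kept disjoint in this sense. -/
def verts (S : Star G k) : Finset V := insert S.centre S.leaves

theorem centre_mem_verts (S : Star G k) : S.centre ∈ S.verts := mem_insert_self _ _

theorem leaves_subset_verts (S : Star G k) : S.leaves ⊆ S.verts := subset_insert _ _

theorem card_verts_le (S : Star G k) : #S.verts ≤ k + 1 :=
  (card_insert_le _ _).trans_eq (by rw [S.card_leaves])

theorem card_biUnion_leaves {ι : Type*} {S : ι → Star G k} {J : Finset ι}
    (hS : Pairwise fun i j => Disjoint (S i).leaves (S j).leaves) :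
    #(J.biUnion fun i => (S i).leaves) = #J * k := by
  rw [card_biUnion fun i _ j _ hij => hS hij, sum_congr rfl fun i _ => (S i).card_leaves,
    sum_const, smul_eq_mul]

end Star

theorem eq_not_of_adj (C : G.Coloring Bool) {u v : V} (h : G.Adj u v) : C v = !C u :=
  Bool.eq_not_of_ne (C.valid h).symm

variable [Fintype V] [DecidableEq V] [DecidableRel G.Adj]

theorem exists_disjoint_stars {ι : Type*} [Fintype ι] {p : V → Prop} {W : Finset V} {k L : ℕ}
    (hstar : ∀ U : Finset V, #U ≤ L → ∃ v, p v ∧ v ∉ U ∧ k ≤ #(G.neighborFinset v \ U))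
    (hL : #W + Fintype.card ι * (k + 1) ≤ L) :
    ∃ S : ι → Star G k, (∀ i, p (S i).centre ∧ Disjoint (S i).verts W) ∧
      Pairwise fun i j => Disjoint (S i).verts (S j).verts := by
  refine exists_pairwise_disjoint_of_avoid (α := fun _ => Star G k)
    (P := fun _ S => p S.centre ∧ Disjoint S.verts W) (foot := fun _ S => S.verts)
    (fun _ S _ => S.card_verts_le) fun _ U hU => ?_
  obtain ⟨v, hv, hvU, hk⟩ := hstar (W ∪ U) ((card_union_le _ _).trans (by omega))
  obtain ⟨leaves, hleaves, hcard⟩ := exists_subset_card_eq hk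
  have hdisj : Disjoint (insert v leaves) (W ∪ U) :=
    Finset.disjoint_insert_left.2 ⟨hvU, sdiff_disjoint.mono_left hleaves⟩
  rw [disjoint_union_right] at hdisj
  exact ⟨⟨v, leaves, fun x hx => (G.mem_neighborFinset _ _).1 (mem_sdiff.1 (hleaves hx)).1, hcard⟩,
    ⟨hv, hdisj.1⟩, hdisj.2⟩

end Star

namespace Regime

variable {n d m t : ℕ}

theorem mul_pow_twenty_le (h : Regime n d m) (ht : t ^ 2 ≤ 4 * d * m ^ 2) : t * m ^ 20 ≤ d := by
  refine (Nat.pow_le_pow_iff_left (n := 2) (by norm_num)).1 ?_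
  have := h.thousand_mul_pow_le (by norm_num : 42 < 43)
  calc (t * m ^ 20) ^ 2 = t ^ 2 * m ^ 40 := by ring
    _ ≤ 4 * d * m ^ 2 * m ^ 40 := Nat.mul_le_mul_right _ ht
    _ = d * (4 * m ^ 42) := by ring
    _ ≤ d * d := Nat.mul_le_mul_left _ (by have := h.pow_le (by norm_num : 43 ≤ 200); omega)
    _ = d ^ 2 := (pow_two d).symm

theorem sq_mul_codegree_le (h : Regime n d m) (ht : t ^ 2 ≤ 4 * d * m ^ 2) :
    4 * (t * t * (2 * m ^ 24) ^ 10) ≤ n :=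
  calc 4 * (t * t * (2 * m ^ 24) ^ 10) = 4096 * t ^ 2 * m ^ 240 := by ring
    _ ≤ 4096 * (4 * d * m ^ 2) * m ^ 240 := by gcongr
    _ = d * m ^ 242 * 16384 := by ring
    _ ≤ d * m ^ 242 * m ^ 2 := by
      gcongr
      nlinarith [h.le_m]
    _ = d * m ^ 244 := by ring
    _ ≤ n := h.mul_pow_le (by norm_num)

theorem pow_nine_mul_le (h : Regime n d m) (ht : t ^ 2 ≤ 4 * d * m ^ 2) (ht0 : 0 < t) {u : ℕ}
    (hu : d ≤ 2 * u) : 2 * (2 * t) ^ 9 * (2 * m ^ 24) ^ 9 ≤ u ^ 8 := by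
  have hm38 : 2 ^ 38 ≤ m ^ 4 :=
    calc 2 ^ 38 ≤ 1000 ^ 4 := by norm_num
      _ ≤ m ^ 4 := Nat.pow_le_pow_left h.le_m 4
  have ht9 : (2 * t) ^ 9 ≤ (16 * d * m ^ 2) ^ 5 :=
    calc (2 * t) ^ 9 ≤ (2 * t) ^ 10 := Nat.pow_le_pow_right (by omega) (by norm_num)
      _ = (4 * t ^ 2) ^ 5 := by ring
      _ ≤ (16 * d * m ^ 2) ^ 5 := Nat.pow_le_pow_left (by linarith) 5
  refine Nat.le_of_mul_le_mul_left (c := 2 ^ 8) ?_ (by norm_num)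
  calc 2 ^ 8 * (2 * (2 * t) ^ 9 * (2 * m ^ 24) ^ 9)
      ≤ 2 ^ 8 * (2 * (16 * d * m ^ 2) ^ 5 * (2 * m ^ 24) ^ 9) := by gcongr
    _ = d ^ 5 * (2 ^ 38 * m ^ 226) := by ring
    _ ≤ d ^ 5 * (m ^ 4 * m ^ 226) := by gcongr
    _ = d ^ 5 * (m ^ 30 * m ^ 200) := by ring
    _ ≤ d ^ 5 * (d ^ 2 * d) := Nat.mul_le_mul_left _ <| Nat.mul_le_mul
      ((h.pow_le (by norm_num : 30 ≤ 200)).trans (Nat.le_self_pow (by norm_num) d)) h.pow_le_d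
    _ = d ^ 8 := by ring
    _ ≤ (2 * u) ^ 8 := Nat.pow_le_pow_left hu 8
    _ = 2 ^ 8 * u ^ 8 := mul_pow _ _ _

end Regime

section Hub

variable {V : Type*} {G : SimpleGraph V}

/-- If `U` absorbed half of the neighbourhood of every vertex of `Side`, dependent random choice
between `Side \ U` and `U` would produce a subdivision with paths of length two. -/
theorem exists_star_avoiding [Fintype V] [DecidableEq V] [DecidableRel G.Adj] {d m t : ℕ}
    {Side U : Finset V} (hreg : Regime (Fintype.card V) d m) (hdeg : ∀ v, d ≤ G.degree v)
    (hSide : Fintype.card V ≤ 2 * #Side) (ht0 : 0 < t) (ht : t ^ 2 ≤ 4 * d * m ^ 2)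
    (hno : ¬ ContainsTK G t 1) (hU : #U ≤ d * m ^ 24) :
    ∃ v ∈ Side, v ∉ U ∧ d ≤ 2 * #(G.neighborFinset v \ U) := by
  by_contra! hcon
  refine hno ?_
  have hdegU : ∀ x ∈ Side \ U, d ≤ 2 * #{u ∈ U | G.Adj x u} := fun x hx => by
    have hout := hcon x (mem_sdiff.1 hx).1 (mem_sdiff.1 hx).2
    have hsplit := card_inter_add_card_sdiff (G.neighborFinset x) U
    have hinter : G.neighborFinset x ∩ U = {u ∈ U | G.Adj x u} := by
      ext v
      simp [and_comm]
    rw [hinter, G.card_neighborFinset_eq_degree] at hsplit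
    have := hdeg x
    omega
  have hcard : Fintype.card V ≤ 4 * #(Side \ U) := by
    have := le_card_sdiff U Side
    have := hreg.thousand_mul_mul_pow_le d (by norm_num : 24 < 25)
    have := hreg.mul_pow_le (by norm_num : 25 ≤ 250)
    omega
  have hd := hreg.d_pos
  have hVpos : 0 < Fintype.card V :=
    hd.trans_le (by simpa using hreg.mul_pow_le (Nat.zero_le _))
  have hSideU : (Side \ U).Nonempty := card_pos.1 (by omega)
  have hdU : d ≤ 2 * #U := by
    obtain ⟨x, hx⟩ := hSideU
    exact (hdegU x hx).trans (Nat.mul_le_mul_left _ (card_filter_le _ _))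
  obtain ⟨T, hTU, hTt, hT⟩ := exists_subset_forall_le_codegree G.Adj (c := 2 * m ^ 24)
    (by have := pow_pos hreg.m_pos 24; omega) hSideU (card_pos.1 (by omega))
    (fun x hx =>
      calc #U ≤ d * m ^ 24 := hU
        _ ≤ 2 * #{u ∈ U | G.Adj x u} * m ^ 24 := Nat.mul_le_mul_right _ (hdegU x hx)
        _ = 2 * m ^ 24 * #{u ∈ U | G.Adj x u} := by ring)
    (Nat.le_of_mul_le_mul_left ((hreg.sq_mul_codegree_le ht).trans hcard) (by norm_num))
    (hreg.pow_nine_mul_le ht ht0 hdU)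
  exact containsTK_one_of_le_codegree (sdiff_disjoint.mono_right hTU) hTt
    fun u hu v hv _ => hT u hu v hv

end Hub

section Link

variable {V : Type*} {G : SimpleGraph V}

theorem Star.eq_not_of_mem_biUnion_leaves [DecidableEq V] (C : G.Coloring Bool) {β : Bool}
    {ι : Type*} {k : ℕ} {S : ι → Star G k} {I : Finset ι} (hS : ∀ i ∈ I, C (S i).centre = β) {v : V}
    (hv : v ∈ I.biUnion fun i => (S i).leaves) : C v = !β := by
  obtain ⟨i, hi, hvi⟩ := mem_biUnion.1 hv
  exact hS i hi ▸ eq_not_of_adj C ((S i).adj v hvi)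

theorem Star.card_filter_centre_mem_le [DecidableEq V] {ι : Type*} [Fintype ι] {k : ℕ}
    {S : ι → Star G k} (hS : Pairwise fun i j => Disjoint (S i).verts (S j).verts) (U : Finset V) :
    #{i | (S i).centre ∈ U} ≤ #U := by
  refine card_le_card_of_injOn (fun i => (S i).centre) (fun i hi => (mem_filter.1 hi).2) ?_
  intro i _ j _ (hij : (S i).centre = (S j).centre)
  by_contra hne
  exact Finset.disjoint_left.1 (hS hne) (S i).centre_mem_verts (hij ▸ (S j).centre_mem_verts)

theorem JoinsLargeSets.exists_isPath_between_stars {C : G.Coloring Bool} {d m : ℕ}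
    (hjoin : JoinsLargeSets C d m) {ι κ : Type*} {kA kB T : ℕ} {A : ι → Star G kA}
    {B : κ → Star G kB} {I : Finset ι} {J : Finset κ} {F : Finset V} {β : Bool}
    (hA : ∀ i ∈ I, C (A i).centre = β ∧ (A i).centre ∈ F)
    (hB : ∀ j ∈ J, C (B j).centre = β ∧ (B j).centre ∈ F)
    (hAB : ∀ i ∈ I, ∀ j ∈ J, (A i).centre ≠ (B j).centre)
    (hAd : Pairwise fun i j => Disjoint (A i).leaves (A j).leaves)
    (hBd : Pairwise fun i j => Disjoint (B i).leaves (B j).leaves)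
    (hI : 2 * d + #F * (m ^ 4 + 1) ≤ #I * kA) (hJ : 2 * d + #F * (m ^ 4 + 1) ≤ #J * kB)
    (hT : Even T) (hmT : m ≤ T) (hTm : T < m ^ 4) :
    ∃ i ∈ I, ∃ j ∈ J, ∃ p : G.Walk (A i).centre (B j).centre, p.IsPath ∧ p.length = T + 2 ∧
      ∀ z ∈ p.support, z ∈ F → z = (A i).centre ∨ z = (B j).centre := by
  classical
  obtain ⟨a, ha, b, hb, p, hp, hpT, hpF⟩ := hjoin
    (fun _ => Star.eq_not_of_mem_biUnion_leaves C fun i hi => (hA i hi).1)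
    (fun _ => Star.eq_not_of_mem_biUnion_leaves C fun j hj => (hB j hj).1)
    (hI.trans_eq (Star.card_biUnion_leaves hAd).symm)
    (hJ.trans_eq (Star.card_biUnion_leaves hBd).symm) hT hmT hTm
  obtain ⟨i, hi, hai⟩ := mem_biUnion.1 ha
  obtain ⟨j, hj, hbj⟩ := mem_biUnion.1 hb
  have hpB : (p.concat ((B j).adj b hbj).symm).IsPath :=
    hp.concat (fun h => hpF _ h (hB j hj).2) _
  refine ⟨i, hi, j, hj, .cons ((A i).adj a hai) (p.concat ((B j).adj b hbj).symm),
    hpB.cons fun h => ?_, by simp [hpT], fun z hz hzF => ?_⟩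
  · rw [Walk.support_concat, List.mem_append, List.mem_singleton] at h
    exact h.elim (fun h => hpF _ h (hA i hi).2) (hAB i hi j hj)
  · rw [Walk.support_cons, Walk.support_concat, List.mem_cons, List.mem_append,
      List.mem_singleton] at hz
    exact hz.imp_right fun h => h.resolve_left fun h => hpF z h hzF

variable {ι κ : Type*} {kA kB r : ℕ}

/-- A path of length `r` between the centres of a star of one family and a star of another. -/
structure Link (A : ι → Star G kA) (B : κ → Star G kB) (r : ℕ) where
  source : ι
  target : κ
  walk : G.Walk (A source).centre (B target).centre
  isPath_walk : walk.IsPath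
  length_walk : walk.length = r

namespace Link

variable {A : ι → Star G kA} {B : κ → Star G kB} [DecidableEq V]

/-- The vertices of a link other than its source: links from a common source may be disjoint only
in this sense. -/
def footprint (x : Link A B r) : Finset V :=
  x.walk.support.toFinset.erase (A x.source).centre

theorem mem_footprint {x : Link A B r} {z : V} :
    z ∈ x.footprint ↔ z ≠ (A x.source).centre ∧ z ∈ x.walk.support := by
  simp [footprint]

theorem card_footprint_le (x : Link A B r) : #x.footprint ≤ r := by
  have := List.toFinset_card_le x.walk.support
  rw [Walk.length_support, x.length_walk] at this
  rw [footprint, card_erase_of_mem (List.mem_toFinset.2 x.walk.start_mem_support)]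
  omega

theorem centre_mem_footprint (hr : 0 < r) (x : Link A B r) :
    (B x.target).centre ∈ x.footprint := by
  refine mem_footprint.2 ⟨fun h => hr.ne' ?_, x.walk.end_mem_support⟩
  rw [← x.length_walk]
  exact Walk.length_eq_zero_iff.2 (x.isPath_walk.nil_iff_eq.2 h.symm)

end Link

theorem JoinsLargeSets.exists_link_avoiding [Fintype ι] [Fintype κ] [DecidableEq V]
    {C : G.Coloring Bool} {d m : ℕ} (hjoin : JoinsLargeSets C d m) {A : ι → Star G kA}
    {B : κ → Star G kB} {W U : Finset V} {β : Bool} {T : ℕ}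
    (hA : ∀ i, C (A i).centre = β ∧ (A i).centre ∈ W)
    (hB : ∀ j, C (B j).centre = β ∧ (B j).centre ∉ W)
    (hAd : Pairwise fun i j => Disjoint (A i).leaves (A j).leaves)
    (hBd : Pairwise fun i j => Disjoint (B i).verts (B j).verts)
    (hU : 2 * #U ≤ Fintype.card κ)
    (hkA : 2 * d + (#W + 2 * Fintype.card κ) * (m ^ 4 + 1) ≤ Fintype.card ι * kA)
    (hkB : 2 * (2 * d + (#W + 2 * Fintype.card κ) * (m ^ 4 + 1)) ≤ Fintype.card κ * kB)
    (hT : Even T) (hmT : m ≤ T) (hTm : T < m ^ 4) :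
    ∃ x : Link A B (T + 2), Disjoint x.footprint (W ∪ U) := by
  set J : Finset κ := {j | (B j).centre ∉ U}
  set F : Finset V := W ∪ U ∪ univ.image fun j => (B j).centre
  have hJ : Fintype.card κ ≤ 2 * #J := by
    have hsplit := card_filter_add_card_filter_not (s := univ) fun j => (B j).centre ∈ U
    rw [card_univ] at hsplit
    have := Star.card_filter_centre_mem_le hBd U
    have : #J = #{j | (B j).centre ∉ U} := rfl
    omega
  have hF : #F ≤ #W + 2 * Fintype.card κ := by
    have : #F ≤ #(W ∪ U) + _ := card_union_le _ _
    have := card_union_le W U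
    have : #(univ.image fun j => (B j).centre) ≤ Fintype.card κ := card_image_le
    omega
  have hFm := Nat.mul_le_mul_right (m ^ 4 + 1) hF
  have hJk : Fintype.card κ * kB ≤ 2 * (#J * kB) :=
    (Nat.mul_le_mul_right kB hJ).trans_eq (mul_assoc _ _ _)
  obtain ⟨i, -, j, hj, p, hp, hpT, hpF⟩ := hjoin.exists_isPath_between_stars
    (I := univ) (J := J) (F := F) (fun i _ => ⟨(hA i).1, by simp [F, hA i]⟩)
    (fun j _ => ⟨(hB j).1, by simp [F]⟩)
    (fun i _ j _ h => (hB j).2 (h ▸ (hA i).2)) hAd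
    (fun i j hij => (hBd hij).mono (B i).leaves_subset_verts (B j).leaves_subset_verts)
    (by rw [card_univ]; omega) (by omega) hT hmT hTm
  refine ⟨⟨i, j, p, hp, hpT⟩, Finset.disjoint_left.2 fun z hz hzF => ?_⟩
  obtain ⟨hzi, hzp⟩ := Link.mem_footprint.1 hz
  obtain rfl := (hpF z hzp (mem_union_left _ hzF)).resolve_left hzi
  exact (mem_union.1 hzF).elim (hB j).2 (mem_filter.1 hj).2

end Link

/-- A spider with `s` arms, each a path of length `r` from the root to the centre of a star with
`k` leaves. The arms share only the root and the stars have disjoint leaf sets, which may however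
meet the arms. -/
structure Hub {V : Type*} (G : SimpleGraph V) (s r k : ℕ) where
  root : V
  star : Fin s → Star G k
  arm : ∀ p, G.Walk root (star p).centre
  isPath_arm : ∀ p, (arm p).IsPath
  length_arm : ∀ p, (arm p).length = r
  eq_root : ∀ p q, p ≠ q → ∀ z ∈ (arm p).support, z ∈ (arm q).support → z = root
  disjoint_leaves : Pairwise fun p q => Disjoint (star p).leaves (star q).leaves

section Hub

variable {V : Type*} [DecidableEq V] {G : SimpleGraph V} {s r k : ℕ}

/-- The vertex set of the spider: the root and the arms, without the leaves of the stars. -/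
def Hub.inner (H : Hub G s r k) : Finset V :=
  insert H.root (univ.biUnion fun p => (H.arm p).support.toFinset)

theorem Hub.mem_inner {H : Hub G s r k} {z : V} :
    z ∈ H.inner ↔ z = H.root ∨ ∃ p, z ∈ (H.arm p).support := by
  simp [inner]

theorem Hub.card_inner_le (H : Hub G s r k) : #H.inner ≤ s * (r + 1) + 1 := by
  refine (card_insert_le _ _).trans (Nat.add_le_add_right ?_ 1)
  refine (card_biUnion_le_card_mul _ _ (r + 1) fun p _ => ?_).trans_eq (by simp)
  exact (List.toFinset_card_le _).trans_eq (by rw [Walk.length_support, H.length_arm])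

theorem exists_hub_of_links {ι κ : Type*} [Fintype ι] [Nonempty ι] {kA Q : ℕ} {A : ι → Star G kA}
    {B : κ → Star G k} (hB : Pairwise fun i j => Disjoint (B i).leaves (B j).leaves) (hr : 0 < r)
    (hQ : Fintype.card ι * s ≤ Q) (x : Fin Q → Link A B r)
    (hx : Pairwise fun i j => Disjoint (x i).footprint (x j).footprint) :
    ∃ i, ∃ H : Hub G s r k, H.root = (A i).centre ∧
      ∀ z ∈ H.inner, z = H.root ∨ ∃ q, z ∈ (x q).footprint := by
  classical
  obtain ⟨i, hi⟩ := Fintype.exists_le_card_fiber_of_mul_le_card (fun q => (x q).source)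
    (hQ.trans_eq (Fintype.card_fin Q).symm)
  obtain ⟨g⟩ : Nonempty (Fin s ↪ {q // (x q).source = i}) := by
    rw [Function.Embedding.nonempty_iff_card_le, Fintype.card_fin, Fintype.card_subtype]
    exact hi
  have hsource p : (A (x (g p)).source).centre = (A i).centre := by rw [(g p).2]
  have hdisj {p q} (hpq : p ≠ q) : Disjoint (x (g p)).footprint (x (g q)).footprint :=
    hx fun h => hpq (g.injective (Subtype.ext h))
  have htarget {p q} (hpq : p ≠ q) : (x (g p)).target ≠ (x (g q)).target := fun h =>
    Finset.disjoint_left.1 (hdisj hpq) (Link.centre_mem_footprint hr _)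
      (h ▸ Link.centre_mem_footprint hr _)
  refine ⟨i, {
    root := (A i).centre
    star := fun p => B (x (g p)).target
    arm := fun p => (x (g p)).walk.copy (hsource p) rfl
    isPath_arm := fun p => by simpa using (x (g p)).isPath_walk
    length_arm := fun p => by simpa using (x (g p)).length_walk
    eq_root := fun p q hpq z hz hz' => by
      rw [Walk.support_copy] at hz hz'
      by_contra hne
      exact Finset.disjoint_left.1 (hdisj hpq) (Link.mem_footprint.2 ⟨hsource p ▸ hne, hz⟩)
        (Link.mem_footprint.2 ⟨hsource q ▸ hne, hz'⟩)
    disjoint_leaves := fun p q hpq => hB (htarget hpq) }, rfl, fun z hz => ?_⟩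
  obtain hz | ⟨p, hz⟩ := Hub.mem_inner.1 hz
  · exact .inl hz
  · rw [Walk.support_copy] at hz
    exact or_iff_not_imp_left.2 fun hne => ⟨g p, Link.mem_footprint.2 ⟨hsource p ▸ hne, hz⟩⟩

end Hub

namespace Regime

variable {n d m t : ℕ}

theorem two_mul_pow_ten_le (h : Regime n d m) (ht : t ^ 2 ≤ 4 * d * m ^ 2) :
    2 * t * m ^ 10 ≤ d / 2 := by
  have := h.thousand_mul_mul_pow_le t (by norm_num : 10 < 20)
  have := h.mul_pow_twenty_le ht
  rw [mul_assoc]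
  omega

theorem pow_nine_add_le (h : Regime n d m) (ht : t ^ 2 ≤ 4 * d * m ^ 2) :
    m ^ 9 + 2 * (t * m ^ 11) ≤ d := by
  have := h.thousand_mul_pow_le (by norm_num : 9 < 10)
  have := h.pow_le (by norm_num : 10 ≤ 200)
  have := h.thousand_mul_mul_pow_le t (by norm_num : 11 < 20)
  have := h.mul_pow_twenty_le ht
  omega

theorem mul_pow_four_add_stars_le (h : Regime n d m) :
    d * m ^ 4 + m ^ 9 * (d / 2 + 1) ≤ d * m ^ 24 := by
  have := h.thousand_mul_mul_pow_le d (by norm_num : 4 < 24)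
  have := h.thousand_mul_mul_pow_le d (by norm_num : 9 < 24)
  have hd := h.d_pos
  have hstars : m ^ 9 * (d / 2 + 1) ≤ 2 * (d * m ^ 9) :=
    calc m ^ 9 * (d / 2 + 1) ≤ m ^ 9 * (2 * d) := by gcongr; omega
      _ = 2 * (d * m ^ 9) := by ring
  omega

theorem mul_pow_four_add_pow_nine_add_stars_le (h : Regime n d m) (ht : t ^ 2 ≤ 4 * d * m ^ 2) :
    d * m ^ 4 + m ^ 9 + t * m ^ 11 * (2 * t * m ^ 10 + 1) ≤ d * m ^ 24 := by
  have hstars : t * m ^ 11 * (2 * t * m ^ 10) ≤ 8 * (d * m ^ 23) :=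
    calc t * m ^ 11 * (2 * t * m ^ 10) = 2 * t ^ 2 * m ^ 21 := by ring
      _ ≤ 2 * (4 * d * m ^ 2) * m ^ 21 := by gcongr
      _ = 8 * (d * m ^ 23) := by ring
  have := h.pow_nine_add_le ht
  have := h.thousand_mul_mul_pow_le d (by norm_num : 23 < 24)
  have := h.thousand_mul_mul_pow_le d (by norm_num : 4 < 23)
  have hd4 := h.thousand_mul_mul_pow_le d (by norm_num : 0 < 4)
  rw [pow_zero, mul_one] at hd4
  rw [Nat.mul_add]
  omega

theorem two_mul_links_le (h : Regime n d m) :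
    2 * (m ^ 9 * (2 * t) * (4 * m + 2)) ≤ t * m ^ 11 := by
  have hm := h.le_m
  calc 2 * (m ^ 9 * (2 * t) * (4 * m + 2)) ≤ 2 * (m ^ 9 * (2 * t) * (5 * m)) := by gcongr; omega
    _ = 20 * (t * m ^ 10) := by ring
    _ ≤ t * m ^ 11 := by
      have := h.thousand_mul_mul_pow_le t (by norm_num : 10 < 11)
      omega

theorem forbidden_le (h : Regime n d m) (ht : t ^ 2 ≤ 4 * d * m ^ 2) :
    2 * d + (d * m ^ 4 + m ^ 9 + 2 * (t * m ^ 11)) * (m ^ 4 + 1) ≤ 4 * (d * m ^ 8) := by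
  have := h.pow_nine_add_le ht
  have := h.thousand_mul_mul_pow_le d (by norm_num : 4 < 8)
  have hd4 := h.thousand_mul_mul_pow_le d (by norm_num : 0 < 4)
  rw [pow_zero, mul_one] at hd4
  calc 2 * d + (d * m ^ 4 + m ^ 9 + 2 * (t * m ^ 11)) * (m ^ 4 + 1)
      ≤ 2 * d + 2 * (d * m ^ 4) * (m ^ 4 + 1) := by gcongr; omega
    _ = 2 * (d * m ^ 8) + 2 * (d * m ^ 4) + 2 * d := by ring
    _ ≤ 4 * (d * m ^ 8) := by omega

theorem mul_pow_eight_le_first_leaves (h : Regime n d m) : 4 * (d * m ^ 8) ≤ m ^ 9 * (d / 2) := by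
  have hd : d ≤ 4 * (d / 2) := by
    have hmd := h.pow_le (by norm_num : 1 ≤ 200)
    have := h.le_m
    rw [pow_one] at hmd
    omega
  have hleaves : d * m ^ 9 ≤ 4 * (m ^ 9 * (d / 2)) :=
    (Nat.mul_le_mul_right _ hd).trans_eq (by ring)
  have := h.thousand_mul_mul_pow_le d (by norm_num : 8 < 9)
  omega

theorem mul_pow_eight_le_second_leaves (h : Regime n d m) (ht' : d ≤ t ^ 2) :
    2 * (4 * (d * m ^ 8)) ≤ t * m ^ 11 * (2 * t * m ^ 10) := by
  have hleaves : d * m ^ 21 ≤ t * m ^ 11 * (2 * t * m ^ 10) :=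
    calc d * m ^ 21 ≤ t ^ 2 * m ^ 21 := by gcongr
      _ ≤ t ^ 2 * m ^ 21 * 2 := Nat.le_mul_of_pos_right _ two_pos
      _ = t * m ^ 11 * (2 * t * m ^ 10) := by ring
  have := h.thousand_mul_mul_pow_le d (by norm_num : 8 < 21)
  omega

theorem mul_card_inner_le (h : Regime n d m) (ht0 : 0 < t) (ht : t ^ 2 ≤ 4 * d * m ^ 2) :
    t * (2 * t * (4 * m + 2 + 1) + 1) ≤ d * m ^ 4 := by
  have hm := h.le_m
  calc t * (2 * t * (4 * m + 2 + 1) + 1) ≤ t * (2 * t * (5 * m)) := by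
        gcongr
        nlinarith
    _ = 10 * t ^ 2 * m := by ring
    _ ≤ 10 * (4 * d * m ^ 2) * m := by gcongr
    _ = 40 * (d * m ^ 3) := by ring
    _ ≤ d * m ^ 4 := by
      have := h.thousand_mul_mul_pow_le d (by norm_num : 3 < 4)
      omega

end Regime

section HubSystem

variable {V : Type*} [Fintype V] [DecidableEq V] {G : SimpleGraph V} [DecidableRel G.Adj]
  {C : G.Coloring Bool} {β : Bool} {d m n t : ℕ} {W : Finset V}

theorem exists_star_families (hreg : Regime n d m) (ht : t ^ 2 ≤ 4 * d * m ^ 2)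
    (hstar : ∀ U : Finset V, #U ≤ d * m ^ 24 →
      ∃ v, C v = β ∧ v ∉ U ∧ d / 2 ≤ #(G.neighborFinset v \ U)) (hW : #W ≤ d * m ^ 4) :
    ∃ (A : Fin (m ^ 9) → Star G (d / 2)) (B : Fin (t * m ^ 11) → Star G (2 * t * m ^ 10)),
      (∀ i, C (A i).centre = β ∧ (A i).centre ∉ W) ∧
      (∀ j, C (B j).centre = β ∧ (B j).centre ∉ W ∪ univ.image fun i => (A i).centre) ∧
      (Pairwise fun i j => Disjoint (A i).verts (A j).verts) ∧
      Pairwise fun i j => Disjoint (B i).verts (B j).verts := by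
  obtain ⟨A, hA, hAd⟩ := exists_disjoint_stars (ι := Fin (m ^ 9)) (W := W) hstar
    ((Nat.add_le_add_right hW _).trans <| by
      simpa only [Fintype.card_fin] using hreg.mul_pow_four_add_stars_le)
  have hcentres : #(W ∪ univ.image fun i => (A i).centre) ≤ d * m ^ 4 + m ^ 9 :=
    (card_union_le _ _).trans (Nat.add_le_add hW (card_image_le.trans_eq (by simp)))
  obtain ⟨B, hB, hBd⟩ := exists_disjoint_stars (ι := Fin (t * m ^ 11)) (k := 2 * t * m ^ 10)
    (W := W ∪ univ.image fun i => (A i).centre)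
    (fun U hU => (hstar U hU).imp fun v hv =>
      ⟨hv.1, hv.2.1, (hreg.two_mul_pow_ten_le ht).trans hv.2.2⟩)
    ((Nat.add_le_add_right hcentres _).trans <| by
      simpa only [Fintype.card_fin] using hreg.mul_pow_four_add_pow_nine_add_stars_le ht)
  exact ⟨A, B, fun i => ⟨(hA i).1, Finset.disjoint_left.1 (hA i).2 (A i).centre_mem_verts⟩,
    fun j => ⟨(hB j).1, Finset.disjoint_left.1 (hB j).2 (B j).centre_mem_verts⟩, hAd, hBd⟩

theorem JoinsLargeSets.exists_hub (hjoin : JoinsLargeSets C d m) (hreg : Regime n d m)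
    (ht' : d ≤ t ^ 2) (ht : t ^ 2 ≤ 4 * d * m ^ 2)
    (hstar : ∀ U : Finset V, #U ≤ d * m ^ 24 →
      ∃ v, C v = β ∧ v ∉ U ∧ d / 2 ≤ #(G.neighborFinset v \ U)) (hW : #W ≤ d * m ^ 4) :
    ∃ H : Hub G (2 * t) (4 * m + 2) (2 * t * m ^ 10), C H.root = β ∧ Disjoint H.inner W := by
  have hm := hreg.le_m
  have hm4 := hreg.thousand_mul_pow_le (by norm_num : 1 < 4)
  have : NeZero (m ^ 9) := ⟨pow_ne_zero 9 hreg.m_pos.ne'⟩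
  obtain ⟨A, B, hA, hB, hAd, hBd⟩ := exists_star_families hreg ht hstar hW
  set W' : Finset V := W ∪ univ.image fun i => (A i).centre
  have hforbidden : 2 * d + (#W' + 2 * (t * m ^ 11)) * (m ^ 4 + 1) ≤ 4 * (d * m ^ 8) := by
    refine le_trans ?_ (hreg.forbidden_le ht)
    gcongr
    exact (card_union_le _ _).trans (Nat.add_le_add hW (card_image_le.trans_eq (by simp)))
  have hsecond := (Nat.mul_le_mul_left 2 hforbidden).trans (hreg.mul_pow_eight_le_second_leaves ht')
  obtain ⟨x, hxW, hxd⟩ := exists_pairwise_disjoint_of_avoid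
    (ι := Fin (m ^ 9 * (2 * t))) (α := fun _ => Link A B (4 * m + 2))
    (P := fun _ x => Disjoint x.footprint W') (foot := fun _ x => x.footprint)
    (fun _ x _ => x.card_footprint_le) fun _ U hU => by
      obtain ⟨x, hx⟩ := hjoin.exists_link_avoiding (U := U) (T := 4 * m)
        (fun i => ⟨(hA i).1, by simp [W']⟩) hB
        (fun i j hij => (hAd hij).mono (A i).leaves_subset_verts (A j).leaves_subset_verts) hBd
        (by
          rw [Fintype.card_fin] at hU ⊢
          exact (Nat.mul_le_mul_left 2 hU).trans hreg.two_mul_links_le)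
        (by simpa using hforbidden.trans hreg.mul_pow_eight_le_first_leaves)
        (by simpa using hsecond)
        ⟨2 * m, by ring⟩ (by omega)
        (by rw [pow_one] at hm4; omega)
      exact ⟨x, disjoint_union_right.1 hx⟩
  obtain ⟨i, H, hroot, hH⟩ := exists_hub_of_links
    (fun i j hij => (hBd hij).mono (B i).leaves_subset_verts (B j).leaves_subset_verts)
    (by omega) (by rw [Fintype.card_fin]) x hxd
  refine ⟨H, hroot ▸ (hA i).1, Finset.disjoint_left.2 fun z hz hzW => ?_⟩
  obtain rfl | ⟨q, hzq⟩ := hH z hz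
  · exact (hA i).2 (hroot ▸ hzW)
  · exact Finset.disjoint_left.1 (hxW q) hzq (mem_union_left _ hzW)

theorem JoinsLargeSets.exists_hub_system (hjoin : JoinsLargeSets C d m) (hreg : Regime n d m)
    (ht' : d ≤ t ^ 2) (ht : t ^ 2 ≤ 4 * d * m ^ 2)
    (hstar : ∀ U : Finset V, #U ≤ d * m ^ 24 →
      ∃ v, C v = β ∧ v ∉ U ∧ d / 2 ≤ #(G.neighborFinset v \ U)) :
    ∃ H : Fin t → Hub G (2 * t) (4 * m + 2) (2 * t * m ^ 10), (∀ i, C (H i).root = β) ∧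
      Pairwise fun i j => Disjoint (H i).inner (H j).inner :=
  exists_pairwise_disjoint_of_avoid (fun _ H _ => H.card_inner_le) fun i U hU =>
    hjoin.exists_hub hreg ht' ht hstar <| hU.trans <| by
      simpa using hreg.mul_card_inner_le i.pos ht

end HubSystem

section Connection

variable {V κ : Type*} {G : SimpleGraph V} {s r k L : ℕ}

/-- A path of length `L` between the roots of two hubs of the family `H`, which follows one arm of
each of the two and meets the spiders of the family nowhere else. -/
structure Connection [DecidableEq V] (H : κ → Hub G s r k) (i j : κ) (L : ℕ) where
  left : Fin s
  right : Fin s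
  walk : G.Walk (H i).root (H j).root
  isPath_walk : walk.IsPath
  length_walk : walk.length = L
  mem_arm : ∀ z ∈ walk.support, ∀ l, z ∈ (H l).inner →
    (l = i ∧ z ∈ ((H i).arm left).support) ∨ (l = j ∧ z ∈ ((H j).arm right).support)

theorem Hub.coloring_centre (K : Hub G s r k) (C : G.Coloring Bool) (hr : Even r) (p : Fin s) :
    C (K.star p).centre = C K.root :=
  (Bool.eq_iff_iff.2 ((C.even_length_iff_congr (K.arm p)).1 (by rwa [K.length_arm]))).symm

variable [DecidableEq V] {H : κ → Hub G s r k} {i j : κ}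

namespace Hub

theorem mem_inner_of_mem_arm {K : Hub G s r k} {p : Fin s} {z : V}
    (hz : z ∈ (K.arm p).support) : z ∈ K.inner :=
  mem_inner.2 (.inr ⟨p, hz⟩)

theorem eq_of_mem_inner (hH : Pairwise fun i j => Disjoint (H i).inner (H j).inner) {z : V}
    (hi : z ∈ (H i).inner) (hj : z ∈ (H j).inner) : i = j := by
  by_contra hij
  exact Finset.disjoint_left.1 (hH hij) hi hj

end Hub

namespace Connection

/-- The interior vertices of a connection. -/
def footprint (x : Connection H i j L) : Finset V :=
  x.walk.support.toFinset \ {(H i).root, (H j).root}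

theorem mem_footprint {x : Connection H i j L} {z : V} :
    z ∈ x.footprint ↔ z ∈ x.walk.support ∧ z ≠ (H i).root ∧ z ≠ (H j).root := by
  simp [footprint]

theorem card_footprint_le (x : Connection H i j L) : #x.footprint ≤ L + 1 :=
  (card_le_card sdiff_subset).trans <| (List.toFinset_card_le _).trans_eq <| by
    rw [Walk.length_support, x.length_walk]

theorem eq_or_eq_of_root_mem_support (x : Connection H i j L) {l : κ}
    (hl : (H l).root ∈ x.walk.support) : l = i ∨ l = j :=
  (x.mem_arm _ hl l (Hub.mem_inner.2 (.inl rfl))).imp And.left And.left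

end Connection

theorem containsTK_of_connections {t ℓ : ℕ} {H : Fin t → Hub G s r k}
    (hH : Pairwise fun i j => Disjoint (H i).inner (H j).inner)
    (x : ∀ q : {q : Fin t × Fin t // q.1 < q.2}, Connection H q.1.1 q.1.2 (ℓ + 1))
    (hx : Pairwise fun p q => Disjoint (x p).footprint (x q).footprint) : ContainsTK G t ℓ := by
  have hinj : Function.Injective fun i => (H i).root := fun i j (hij : (H i).root = _) =>
    Hub.eq_of_mem_inner hH (Hub.mem_inner.2 (.inl rfl)) (hij ▸ Hub.mem_inner.2 (.inl rfl))
  refine ⟨⟨_, hinj⟩, fun i j hij => (x ⟨(i, j), hij⟩).walk,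
    fun i j hij => ⟨(x ⟨(i, j), hij⟩).isPath_walk, (x ⟨(i, j), hij⟩).length_walk⟩,
    fun i j hij l hl => (x ⟨(i, j), hij⟩).eq_or_eq_of_root_mem_support hl, ?_⟩
  intro i j hij i' j' hij' hne v hv hvi hvj hv'
  have hroot l : v ≠ (H l).root := by
    rintro rfl
    obtain rfl | rfl := (x ⟨(i, j), hij⟩).eq_or_eq_of_root_mem_support hv
    exacts [hvi rfl, hvj rfl]
  exact Finset.disjoint_left.1
    (hx (i := ⟨(i, j), hij⟩) (j := ⟨(i', j'), hij'⟩) (mt (congrArg Subtype.val) hne))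
    (Connection.mem_footprint.2 ⟨hv, hroot i, hroot j⟩)
    (Connection.mem_footprint.2 ⟨hv', hroot i', hroot j'⟩)

theorem exists_connection_of_isPath (hH : Pairwise fun i j => Disjoint (H i).inner (H j).inner)
    (hij : i ≠ j) {p q : Fin s} {w : G.Walk ((H i).star p).centre ((H j).star q).centre}
    (hw : w.IsPath) (hwL : w.length = L)
    (hwH : ∀ z ∈ w.support, ∀ l, z ∈ (H l).inner →
      z = ((H i).star p).centre ∨ z = ((H j).star q).centre) :
    ∃ x : Connection H i j (r + L + r), ∀ z ∈ x.walk.support,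
      z ∈ ((H i).arm p).support ∨ z ∈ w.support ∨ z ∈ ((H j).arm q).support := by
  have harm {z} (hz : z ∈ ((H i).arm p).support) (hz' : z ∈ ((H j).arm q).support) : False :=
    hij (Hub.eq_of_mem_inner hH (Hub.mem_inner_of_mem_arm hz) (Hub.mem_inner_of_mem_arm hz'))
  have hpw : (((H i).arm p).append w).IsPath :=
    isPath_append ((H i).isPath_arm p) hw fun z hz hzw =>
      (hwH z hzw i (Hub.mem_inner_of_mem_arm hz)).resolve_right fun h =>
        harm hz (h ▸ ((H j).arm q).end_mem_support)
  have hpwq : ((((H i).arm p).append w).append ((H j).arm q).reverse).IsPath := by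
    refine isPath_append hpw ((H j).isPath_arm q).reverse fun z hz hzq => ?_
    rw [Walk.support_reverse, List.mem_reverse] at hzq
    have hzw := ((Walk.mem_support_append_iff _ _).1 hz).resolve_left (harm · hzq)
    exact (hwH z hzw j (Hub.mem_inner_of_mem_arm hzq)).resolve_left fun h =>
      harm (h ▸ ((H i).arm p).end_mem_support) hzq
  have hsupport {z} : z ∈ ((((H i).arm p).append w).append ((H j).arm q).reverse).support ↔
      z ∈ ((H i).arm p).support ∨ z ∈ w.support ∨ z ∈ ((H j).arm q).support := by
    rw [Walk.mem_support_append_iff, Walk.mem_support_append_iff, Walk.support_reverse,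
      List.mem_reverse, or_assoc]
  refine ⟨⟨p, q, _, hpwq, by simp [(H i).length_arm, (H j).length_arm, hwL],
    fun z hz l hzl => ?_⟩, fun z => hsupport.1⟩
  have hz_arm : z ∈ ((H i).arm p).support ∨ z ∈ ((H j).arm q).support := by
    rcases hsupport.1 hz with h | h | h
    · exact .inl h
    · obtain rfl | rfl := hwH z h l hzl
      exacts [.inl (Walk.end_mem_support _), .inr (Walk.end_mem_support _)]
    · exact .inr h
  exact hz_arm.imp (fun h => ⟨Hub.eq_of_mem_inner hH hzl (Hub.mem_inner_of_mem_arm h), h⟩)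
    fun h => ⟨Hub.eq_of_mem_inner hH hzl (Hub.mem_inner_of_mem_arm h), h⟩

theorem JoinsLargeSets.exists_connection_avoiding [Fintype κ] {C : G.Coloring Bool} {d m T : ℕ}
    (hjoin : JoinsLargeSets C d m) {β : Bool} (hroot : ∀ l, C (H l).root = β)
    (hH : Pairwise fun i j => Disjoint (H i).inner (H j).inner) (hr : Even r) (hij : i ≠ j)
    {I J : Finset (Fin s)} {U : Finset V}
    (hI : ∀ p ∈ I, ∀ z ∈ ((H i).arm p).support, z ∈ U → z = (H i).root)
    (hJ : ∀ p ∈ J, ∀ z ∈ ((H j).arm p).support, z ∈ U → z = (H j).root)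
    (hkI : 2 * d + #(U ∪ univ.biUnion fun l => (H l).inner) * (m ^ 4 + 1) ≤ #I * k)
    (hkJ : 2 * d + #(U ∪ univ.biUnion fun l => (H l).inner) * (m ^ 4 + 1) ≤ #J * k)
    (hT : Even T) (hmT : m ≤ T) (hTm : T < m ^ 4) (hL : r + (T + 2) + r = L) :
    ∃ x : Connection H i j L, Disjoint x.footprint U := by
  subst hL
  have hinner l {z : V} (hz : z ∈ (H l).inner) : z ∈ U ∪ univ.biUnion fun l => (H l).inner :=
    mem_union_right _ (mem_biUnion.2 ⟨l, mem_univ l, hz⟩)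
  have hmem l p : ((H l).star p).centre ∈ (H l).inner :=
    Hub.mem_inner_of_mem_arm (Walk.end_mem_support _)
  have hcentre l p : C ((H l).star p).centre = β ∧
      ((H l).star p).centre ∈ U ∪ univ.biUnion fun l => (H l).inner :=
    ⟨((H l).coloring_centre C hr p).trans (hroot l), hinner l (hmem l p)⟩
  obtain ⟨p, hp, q, hq, w, hw, hwT, hwF⟩ := hjoin.exists_isPath_between_stars
    (fun p _ => hcentre i p) (fun q _ => hcentre j q)
    (fun p _ q _ h => hij <| Hub.eq_of_mem_inner hH (hmem i p) (h ▸ hmem j q))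
    (H i).disjoint_leaves (H j).disjoint_leaves hkI hkJ hT hmT hTm
  obtain ⟨x, hx⟩ := exists_connection_of_isPath hH hij hw hwT fun z hz l hzl =>
    hwF z hz (hinner l hzl)
  refine ⟨x, Finset.disjoint_left.2 fun z hz hzU => ?_⟩
  obtain ⟨hzx, hzi, hzj⟩ := Connection.mem_footprint.1 hz
  have hzp : z ∉ ((H i).arm p).support := fun h => hzi (hI p hp z h hzU)
  have hzq : z ∉ ((H j).arm q).support := fun h => hzj (hJ q hq z h hzU)
  obtain rfl | rfl := hwF z (((hx z hzx).resolve_left hzp).resolve_right hzq)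
    (mem_union_left _ hzU)
  exacts [hzp (Walk.end_mem_support _), hzq (Walk.end_mem_support _)]

end Connection

theorem Regime.two_mul_add_mul_le {n d m t : ℕ} (h : Regime n d m) (ht' : d ≤ t ^ 2)
    (ht : t ^ 2 ≤ 4 * d * m ^ 2) :
    2 * d + (t ^ 2 * (80 * m ^ 3 + 1) + d * m ^ 4) * (m ^ 4 + 1) ≤ t * (2 * t * m ^ 10) := by
  have hm3 : 1 ≤ m ^ 3 := Nat.one_le_pow _ _ h.m_pos
  have hfoot : t ^ 2 * (80 * m ^ 3 + 1) ≤ 324 * (d * m ^ 5) :=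
    calc t ^ 2 * (80 * m ^ 3 + 1) ≤ 4 * d * m ^ 2 * (81 * m ^ 3) := by gcongr; omega
      _ = 324 * (d * m ^ 5) := by ring
  have hd0 := h.thousand_mul_mul_pow_le d (by norm_num : 0 < 6)
  have := h.thousand_mul_mul_pow_le d (by norm_num : 4 < 5)
  have := h.thousand_mul_mul_pow_le d (by norm_num : 5 < 6)
  have := h.thousand_mul_mul_pow_le d (by norm_num : 6 < 10)
  rw [pow_zero, mul_one] at hd0
  calc 2 * d + (t ^ 2 * (80 * m ^ 3 + 1) + d * m ^ 4) * (m ^ 4 + 1)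
      ≤ 2 * d + d * m ^ 6 * (m ^ 4 + 1) := by gcongr; omega
    _ = 2 * d + d * m ^ 6 + d * m ^ 10 := by ring
    _ ≤ 2 * (d * m ^ 10) := by omega
    _ ≤ 2 * (t ^ 2 * m ^ 10) := by gcongr
    _ = t * (2 * t * m ^ 10) := by ring

section Assembly

variable {V : Type*} [DecidableEq V] {G : SimpleGraph V} {s r k t L : ℕ}
  {H : Fin t → Hub G s r k}

theorem exists_free_arms {S : Finset {q : Fin t × Fin t // q.1 < q.2}}
    (x : ∀ q : S, Connection H q.1.1.1 q.1.1.2 L) (i : Fin t) :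
    ∃ I : Finset (Fin s), s ≤ #I + t ∧ ∀ p ∈ I, ∀ z ∈ ((H i).arm p).support,
      z ∈ univ.biUnion (fun q => (x q).footprint) → z = (H i).root := by
  classical
  set I : Finset (Fin s) := {p | ∀ z ∈ ((H i).arm p).support,
    z ∈ univ.biUnion (fun q => (x q).footprint) → z = (H i).root}
  have hIc : #Iᶜ ≤ #(univ : Finset (Fin t)) := by
    refine card_le_card_of_forall_subsingleton (fun p l => ∃ q : S,
      (q.1.1 = (i, l) ∧ (x q).left = p) ∨ (q.1.1 = (l, i) ∧ (x q).right = p)) ?_ ?_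
    · intro p hp
      obtain ⟨z, hzp, hzU, hz⟩ : ∃ z ∈ ((H i).arm p).support,
          z ∈ univ.biUnion (fun q => (x q).footprint) ∧ z ≠ (H i).root := by
        simpa only [I, mem_compl, mem_filter_univ, not_forall, exists_prop] using hp
      obtain ⟨⟨⟨⟨a, b⟩, hab⟩, hq⟩, -, hzx⟩ := mem_biUnion.1 hzU
      obtain ⟨rfl, hz'⟩ | ⟨rfl, hz'⟩ := (x _).mem_arm z (Connection.mem_footprint.1 hzx).1 i
        (Hub.mem_inner_of_mem_arm hzp)
      · exact ⟨b, mem_univ b, _, .inl ⟨rfl, by_contra fun h => hz ((H _).eq_root _ _ h z hz' hzp)⟩⟩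
      · exact ⟨a, mem_univ a, _, .inr ⟨rfl, by_contra fun h => hz ((H _).eq_root _ _ h z hz' hzp)⟩⟩
    · rintro l - p ⟨-, q, hq⟩ p' ⟨-, q', hq'⟩
      have hne (y y' : S) (h : y.1.1 = (i, l)) (h' : y'.1.1 = (l, i)) : False :=
        lt_asymm (by simpa [h] using y.1.2) (by simpa [h'] using y'.1.2)
      have heq {c} (h : q.1.1 = c) (h' : q'.1.1 = c) : q = q' :=
        Subtype.ext (Subtype.ext (h.trans h'.symm))
      obtain ⟨hq, rfl⟩ | ⟨hq, rfl⟩ := hq <;> obtain ⟨hq', rfl⟩ | ⟨hq', rfl⟩ := hq'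
      · rw [heq hq hq']
      · exact (hne q q' hq hq').elim
      · exact (hne q' q hq' hq).elim
      · rw [heq hq hq']
  refine ⟨I, ?_, fun p hp => (mem_filter.1 hp).2⟩
  have := card_add_card_compl I
  rw [card_univ, Fintype.card_fin] at hIc
  rw [Fintype.card_fin] at this
  omega

variable {C : G.Coloring Bool} {β : Bool} {d m n ℓ : ℕ}

theorem card_footprints_union_inners_le (hreg : Regime n d m) (ht0 : 0 < t)
    (ht : t ^ 2 ≤ 4 * d * m ^ 2) {H : Fin t → Hub G (2 * t) (4 * m + 2) k}
    {S : Finset {q : Fin t × Fin t // q.1 < q.2}} (x : ∀ q : S, Connection H q.1.1.1 q.1.1.2 L) :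
    #(univ.biUnion (fun q => (x q).footprint) ∪ univ.biUnion fun l => (H l).inner) ≤
      t ^ 2 * (L + 1) + d * m ^ 4 := by
  have hS : #S ≤ t ^ 2 :=
    (card_le_univ S).trans ((Fintype.card_subtype_le _).trans_eq (by simp [sq]))
  refine (card_union_le _ _).trans (Nat.add_le_add ?_ ?_)
  · refine (card_biUnion_le_card_mul _ _ _ fun q _ => (x q).card_footprint_le).trans ?_
    rw [card_univ, Fintype.card_coe]
    exact Nat.mul_le_mul_right _ hS
  · refine (card_biUnion_le_card_mul _ _ _ fun l _ => (H l).card_inner_le).trans ?_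
    rw [card_univ, Fintype.card_fin]
    exact hreg.mul_card_inner_le ht0 ht

theorem JoinsLargeSets.exists_connections (hjoin : JoinsLargeSets C d m) (hreg : Regime n d m)
    (ht' : d ≤ t ^ 2) (ht : t ^ 2 ≤ 4 * d * m ^ 2)
    {H : Fin t → Hub G (2 * t) (4 * m + 2) (2 * t * m ^ 10)} (hroot : ∀ i, C (H i).root = β)
    (hH : Pairwise fun i j => Disjoint (H i).inner (H j).inner) (hL : L = 80 * m ^ 3) :
    ∃ x : ∀ q : {q : Fin t × Fin t // q.1 < q.2}, Connection H q.1.1 q.1.2 L,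
      Pairwise fun p q => Disjoint (x p).footprint (x q).footprint := by
  have hm := hreg.le_m
  have hm3 := hreg.thousand_mul_pow_le (by norm_num : 1 < 3)
  have hm4 := hreg.thousand_mul_pow_le (by norm_num : 3 < 4)
  rw [pow_one] at hm3
  obtain ⟨x, -, hx⟩ := exists_pairwise_disjoint_of_extend
    (α := fun q : {q : Fin t × Fin t // q.1 < q.2} => Connection H q.1.1 q.1.2 L)
    (P := fun _ _ => True) (foot := fun _ x => x.footprint) fun S f _ q _ => by
      set U := univ.biUnion fun p => (f p).footprint
      have harms {I : Finset (Fin (2 * t))} (hI : 2 * t ≤ #I + t) : 2 * d +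
          #(U ∪ univ.biUnion fun l => (H l).inner) * (m ^ 4 + 1) ≤ #I * (2 * t * m ^ 10) :=
        calc _ ≤ 2 * d + (t ^ 2 * (80 * m ^ 3 + 1) + d * m ^ 4) * (m ^ 4 + 1) := by
              gcongr
              exact hL ▸ card_footprints_union_inners_le hreg q.1.1.pos ht f
          _ ≤ t * (2 * t * m ^ 10) := hreg.two_mul_add_mul_le ht' ht
          _ ≤ #I * (2 * t * m ^ 10) := by gcongr; omega
      obtain ⟨I, hIt, hI⟩ := exists_free_arms f q.1.1
      obtain ⟨J, hJt, hJ⟩ := exists_free_arms f q.1.2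
      obtain ⟨x, hx⟩ := hjoin.exists_connection_avoiding (T := 80 * m ^ 3 - 8 * m - 6) (L := L)
        hroot hH ⟨2 * m + 1, by ring⟩ q.2.ne hI hJ (harms hIt) (harms hJt)
        ⟨40 * m ^ 3 - 4 * m - 3, by omega⟩ (by omega) (by omega) (by omega)
      exact ⟨x, trivial, fun p => hx.mono_right
        (subset_biUnion_of_mem (fun p => (f p).footprint) (mem_univ p))⟩
  exact ⟨x, hx⟩

variable [Fintype V] [DecidableRel G.Adj]

theorem JoinsLargeSets.containsTK (hjoin : JoinsLargeSets C d m) (hreg : Regime n d m)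
    (ht' : d ≤ t ^ 2) (ht : t ^ 2 ≤ 4 * d * m ^ 2)
    (hstar : ∀ U : Finset V, #U ≤ d * m ^ 24 →
      ∃ v, C v = β ∧ v ∉ U ∧ d / 2 ≤ #(G.neighborFinset v \ U)) (hℓ : ℓ + 1 = 80 * m ^ 3) :
    ContainsTK G t ℓ := by
  obtain ⟨H, hroot, hH⟩ := hjoin.exists_hub_system hreg ht' ht hstar
  obtain ⟨x, hx⟩ := hjoin.exists_connections hreg ht' ht hroot hH hℓ
  exact containsTK_of_connections hH x hx

end Assembly

section RobustExpansion

variable {V : Type*} {G : SimpleGraph V}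

theorem ncard_edgeSet_between_le [DecidableRel G.Adj] (X Z : Finset V) :
    (G.between X Z).edgeSet.ncard ≤ #(G.interedges X Z) := by
  classical
  have hsub : (G.between X Z).edgeSet ⊆
      ((G.interedges X Z).image fun p => s(p.1, p.2) : Finset (Sym2 V)) := by
    rintro ⟨u, v⟩ ⟨huv, ⟨hu, hv⟩ | ⟨hu, hv⟩⟩
    · exact mem_image.2 ⟨(u, v), (G.mem_interedges_iff).2 ⟨hu, hv, huv⟩, rfl⟩
    · exact mem_image.2 ⟨(v, u), (G.mem_interedges_iff).2 ⟨hv, hu, huv.symm⟩, Sym2.eq_swap⟩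
  refine (Set.ncard_le_ncard hsub (finite_toSet _)).trans ?_
  rw [Set.ncard_coe_finset]
  exact card_image_le

theorem ncard_extNbhd_sdiff_between_le [Fintype V] [DecidableEq V] (X Z : Finset V) :
    (extNbhd (G \ G.between X Z) (X : Set V)).ncard ≤ #(X ∪ Z)ᶜ := by
  rw [← Set.ncard_coe_finset]
  refine Set.ncard_le_ncard ?_ (finite_toSet _)
  rintro w ⟨hwX, v, hvX, hadj, hbetween⟩
  rw [mem_coe, mem_compl, mem_union]
  rintro (hw | hw)
  · exact hwX hw
  · exact hbetween ⟨hadj, Or.inl ⟨hvX, hw⟩⟩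

variable [Fintype V] [DecidableRel G.Adj]

theorem two_le_card_of_minDegree_pos (h : 0 < G.minDegree) : 2 ≤ Fintype.card V := by
  rcases isEmpty_or_nonempty V with hV | hV
  · simp at h
  · exact lt_of_le_of_lt h G.minDegree_lt_card

theorem le_avgDegree [Nonempty V] {d : ℕ} (hdeg : ∀ v, d ≤ G.degree v) : d ≤ avgDegree G := by
  rw [avgDegree, le_div_iff₀ (by exact_mod_cast Fintype.card_pos), mul_comm, ← nsmul_eq_mul]
  exact card_nsmul_le_sum univ _ (d : ℝ) fun v _ => by exact_mod_cast hdeg v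

theorem IsRobustExpander.edgeExpanding [DecidableEq V] {ε₁ k : ℝ} {d e : ℕ}
    (h : IsRobustExpander G ε₁ k) (hdeg : ∀ v, d ≤ G.degree v) (hkd : k / 2 ≤ d)
    (hexp : ∀ x : ℝ, d ≤ x → x ≤ Fintype.card V / 2 → 1 ≤ e * expansion ε₁ k x) :
    EdgeExpanding G d e := by
  intro X Z _ hdX hXn hmissed
  by_contra! hfew
  obtain ⟨x, -⟩ := card_pos.1 (Nat.zero_le _ |>.trans_lt hmissed)
  have : Nonempty V := ⟨x⟩
  have hdX' : (d : ℝ) ≤ #X := by exact_mod_cast hdX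
  have hXn' : (#X : ℝ) ≤ Fintype.card V / 2 := by
    rw [le_div_iff₀' two_pos]
    exact_mod_cast hXn
  have hε := hexp #X hdX' hXn'
  set ε := expansion ε₁ k #X
  have hε0 : 0 ≤ ε := (pos_of_mul_pos_right (one_pos.trans_le hε) e.cast_nonneg).le
  set F := G.between X Z
  have hF : (F.edgeSet.ncard : ℝ) * e ≤ d * #X := by
    rw [mul_comm]
    exact_mod_cast (Nat.mul_le_mul_left e (ncard_edgeSet_between_le X Z)).trans hfew
  have hremovable : (F.edgeSet.ncard : ℝ) ≤ avgDegree G * ε * #X :=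
    calc (F.edgeSet.ncard : ℝ) ≤ F.edgeSet.ncard * (e * ε) :=
          le_mul_of_one_le_right (Nat.cast_nonneg _) hε
      _ = (F.edgeSet.ncard * e) * ε := by ring
      _ ≤ (d * #X) * ε := by gcongr
      _ ≤ (avgDegree G * #X) * ε := by gcongr; exact le_avgDegree hdeg
      _ = avgDegree G * ε * #X := by ring
  have hexpands := h X (hkd.trans hdX') hXn' F between_le hremovable
  have hmany : (#X : ℝ) ≤ e * #(X ∪ Z)ᶜ :=
    calc (#X : ℝ) ≤ (e * ε) * #X := le_mul_of_one_le_left (Nat.cast_nonneg _) hε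
      _ = e * (ε * #X) := by ring
      _ ≤ e * (extNbhd (G \ F) (X : Set V)).ncard := by gcongr
      _ ≤ e * #(X ∪ Z)ᶜ := by gcongr; exact ncard_extNbhd_sdiff_between_le X Z
  exact hmissed.not_ge (by exact_mod_cast hmany)

end RobustExpansion

section Parameters

open Real

theorem one_le_mul_expansion {ε₁ ε₂ d n x e : ℝ} (hε₁ : 0 < ε₁) (hε₂ : 0 < ε₂) (hε₂' : ε₂ < 1)
    (hd : 0 < d) (hL : 15 / ε₂ ≤ log (n / d)) (he : 4 * log (n / d) ^ 2 / ε₁ ≤ e) (hdx : d ≤ x)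
    (hxn : x ≤ n / 2) : 1 ≤ e * expansion ε₁ (ε₂ * d) x := by
  have hx : 0 < x := hd.trans_le hdx
  have hn : 0 < n := by linarith
  have hεd : ε₂ * d ≤ d := mul_le_of_le_one_left hd.le hε₂'.le
  have hone : 1 < 15 * x / (ε₂ * d) := by
    rw [one_lt_div (by positivity)]
    linarith
  have hlog0 : 0 < log (15 * x / (ε₂ * d)) := log_pos hone
  have hlog : log (15 * x / (ε₂ * d)) ≤ 2 * log (n / d) :=
    calc log (15 * x / (ε₂ * d)) ≤ log ((15 / ε₂) * (n / d)) := by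
          rw [div_mul_div_comm]
          gcongr
          linarith
      _ = log (15 / ε₂) + log (n / d) := log_mul (by positivity) (by positivity)
      _ ≤ 2 * log (n / d) := by linarith [log_le_self (show 0 ≤ 15 / ε₂ by positivity)]
  rw [expansion, if_neg (by linarith), mul_div_assoc', le_div_iff₀ (by positivity), one_mul]
  calc log (15 * x / (ε₂ * d)) ^ 2 ≤ (2 * log (n / d)) ^ 2 := by gcongr
    _ = 4 * log (n / d) ^ 2 := by ring
    _ ≤ e * ε₁ := (div_le_iff₀ hε₁).1 he

theorem mul_pow_le_mul_succ_pow {n d : ℝ} {a r : ℕ} (hn : 0 < n) (hd : 0 < d) (ha : 0 < a)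
    (h : log (n / d) * (a + 1) ≤ r) : n * a ^ r ≤ d * (a + 1) ^ r := by
  have : (0 : ℝ) < a := by exact_mod_cast ha
  have hlog : 1 / (a + 1) ≤ log ((a + 1) / a) := by
    refine le_of_eq_of_le ?_ (one_sub_inv_le_log_of_pos (by positivity))
    field_simp
    ring
  have hratio : n / d ≤ ((a + 1) / a) ^ r := by
    rw [← log_le_log_iff (by positivity) (by positivity), log_pow]
    calc log (n / d) ≤ r * (1 / (a + 1)) := by
          rwa [mul_one_div, le_div_iff₀ (by positivity)]
      _ ≤ r * log ((a + 1) / a) := by gcongr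
  rwa [div_pow, div_le_div_iff₀ hd (by positivity), mul_comm _ d] at hratio

theorem mul_four_mul_ceil_add_one_le {ε L : ℝ} (hε : 0 < ε) (hε' : ε < 1) (hL : 160 / ε ≤ L) :
    L * (4 * ⌈4 * L ^ 2 / ε⌉₊ + 1) ≤ (⌊L ^ 4⌋₊ / 4 : ℕ) := by
  have hεL : 160 ≤ L * ε := (div_le_iff₀ hε).1 hL
  have hL160 : 160 ≤ L := by nlinarith
  have hceil : (⌈4 * L ^ 2 / ε⌉₊ : ℝ) < 4 * L ^ 2 / ε + 1 := Nat.ceil_lt_add_one (by positivity)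
  have hquot : 40 * (4 * L ^ 2 / ε) ≤ L ^ 3 := by
    rw [← mul_div_assoc, div_le_iff₀ hε]
    nlinarith [mul_le_mul_of_nonneg_left hεL (sq_nonneg L)]
  have hcube : 160 ^ 3 ≤ L ^ 3 := by gcongr
  have hfloor : L ^ 4 / 8 ≤ (⌊L ^ 4⌋₊ / 4 : ℕ) := by
    have hquarter : (⌊L ^ 4⌋₊ : ℝ) < 4 * (⌊L ^ 4⌋₊ / 4 : ℕ) + 4 := by
      exact_mod_cast (by omega : ⌊L ^ 4⌋₊ < 4 * (⌊L ^ 4⌋₊ / 4) + 4)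
    have hfour : 160 ^ 4 ≤ L ^ 4 := by gcongr
    linarith [Nat.lt_floor_add_one (L ^ 4)]
  calc L * (4 * ⌈4 * L ^ 2 / ε⌉₊ + 1) ≤ L * (L ^ 3 / 8) := by gcongr; linarith
    _ = L ^ 4 / 8 := by ring
    _ ≤ (⌊L ^ 4⌋₊ / 4 : ℕ) := hfloor

theorem regime_mParam {d : ℝ} {n : ℕ} (hd : 1 ≤ d) (hL : 6 ≤ log (n / d))
    (hpow : 2 * log (n / d) ^ 1000 ≤ n / d) (hlog : log n ^ 800 ≤ d) :
    Regime n ⌈d⌉₊ (mParam n d) where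
  le_m := Nat.le_floor <| calc
    ((1000 : ℕ) : ℝ) ≤ 6 ^ 4 := by norm_num
    _ ≤ log (n / d) ^ 4 := by gcongr
  pow_le_d := by
    have hfloor : (mParam n d : ℝ) ≤ log (n / d) ^ 4 := Nat.floor_le (by positivity)
    have hn : (0 : ℝ) < n / d := lt_of_lt_of_le (by positivity) hpow
    have hm : (mParam n d : ℝ) ^ 200 ≤ ⌈d⌉₊ :=
      calc (mParam n d : ℝ) ^ 200 ≤ (log (n / d) ^ 4) ^ 200 := by gcongr
        _ = log (n / d) ^ 800 := by rw [← pow_mul]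
        _ ≤ log n ^ 800 := by
          gcongr
          exact div_le_self n.cast_nonneg hd
        _ ≤ d := hlog
        _ ≤ ⌈d⌉₊ := Nat.le_ceil d
    exact_mod_cast hm
  mul_pow_le_n := by
    have hfloor : (mParam n d : ℝ) ≤ log (n / d) ^ 4 := Nat.floor_le (by positivity)
    have hn : (⌈d⌉₊ : ℝ) * mParam n d ^ 250 ≤ n :=
      calc (⌈d⌉₊ : ℝ) * mParam n d ^ 250 ≤ (2 * d) * (log (n / d) ^ 4) ^ 250 := by
            gcongr
            linarith [Nat.ceil_lt_add_one (zero_le_one.trans hd)]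
        _ = d * (2 * log (n / d) ^ 1000) := by rw [← pow_mul]; ring
        _ ≤ d * (n / d) := by gcongr
        _ = n := mul_div_cancel₀ _ (by positivity)
    exact_mod_cast hn

theorem exists_forall_two_mul_pow_le_exp (j : ℕ) : ∃ Λ : ℝ, ∀ L ≥ Λ, 2 * L ^ j ≤ exp L := by
  obtain ⟨Λ, hΛ⟩ := Filter.eventually_atTop.1
    (((tendsto_exp_div_pow_atTop j).eventually_ge_atTop 2).and (Filter.eventually_gt_atTop 0))
  exact ⟨Λ, fun L hL => (le_div_iff₀ (pow_pos (hΛ L hL).2 j)).1 (hΛ L hL).1⟩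

theorem ceil_le_ceil_sqrt_mul_sq {d : ℝ} {m : ℕ} (hd : 1 ≤ d) (hm : 2 ≤ m) :
    ⌈d⌉₊ ≤ ⌈√d * m⌉₊ ^ 2 := by
  have hm' : (2 : ℝ) ≤ m := by exact_mod_cast hm
  refine Nat.ceil_le.2 ?_
  calc d = √d ^ 2 := (sq_sqrt (by linarith)).symm
    _ ≤ (√d * m) ^ 2 := by gcongr; exact le_mul_of_one_le_right (sqrt_nonneg d) (by linarith)
    _ ≤ ((⌈√d * m⌉₊ ^ 2 : ℕ) : ℝ) := by push_cast; gcongr; exact Nat.le_ceil _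

theorem ceil_sqrt_mul_sq_le {d : ℝ} {m : ℕ} (hd : 1 ≤ d) (hm : 1 ≤ m) :
    ⌈√d * m⌉₊ ^ 2 ≤ 4 * ⌈d⌉₊ * m ^ 2 := by
  have hone : 1 ≤ √d * m := one_le_mul_of_one_le_of_one_le (one_le_sqrt.2 hd) (by exact_mod_cast hm)
  have hsq : (⌈√d * m⌉₊ : ℝ) ^ 2 ≤ 4 * ⌈d⌉₊ * m ^ 2 :=
    calc (⌈√d * m⌉₊ : ℝ) ^ 2 ≤ (2 * (√d * m)) ^ 2 := by
          gcongr
          linarith [Nat.ceil_lt_add_one (zero_le_one.trans hone)]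
      _ = 4 * d * m ^ 2 := by rw [mul_pow, mul_pow, sq_sqrt (by linarith)]; ring
      _ ≤ 4 * ⌈d⌉₊ * m ^ 2 := by gcongr; exact Nat.le_ceil d
  exact_mod_cast hsq

theorem one_le_of_log_pow_le {d K : ℝ} {n : ℕ} (hn : 2 ≤ n) (hK : 2 ^ 802 ≤ K) (hKd : K * d ≤ n)
    (hlog : log n ^ 800 ≤ d) : 1 ≤ d := by
  by_contra! hd
  have hn' : (2 : ℝ) ≤ n := by exact_mod_cast hn
  have hlog_ge : 1 / 2 ≤ log n :=
    calc 1 / 2 ≤ log 2 := by linarith [log_two_gt_d9]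
      _ ≤ log n := log_le_log two_pos hn'
  have hlog_lt : log n < 1 := by
    by_contra! h
    linarith [one_le_pow₀ (n := 800) h]
  have hn_lt : (n : ℝ) < 3 := by
    linarith [(log_lt_iff_lt_exp (by linarith)).1 hlog_lt, exp_one_lt_d9]
  have hK0 : 0 ≤ K := (pow_nonneg two_pos.le _).trans hK
  have hKd_ge : 4 ≤ K * d :=
    calc (4 : ℝ) = 2 ^ 2 * (2 * (1 / 2)) ^ 800 := by norm_num
      _ = 2 ^ 802 * (1 / 2) ^ 800 := by rw [mul_pow, ← mul_assoc, ← pow_add]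
      _ ≤ K * log n ^ 800 := by gcongr
      _ ≤ K * d := by gcongr
  linarith

end Parameters

section Dichotomy

variable {V : Type*} [Fintype V] {G : SimpleGraph V} [DecidableRel G.Adj] {C : G.Coloring Bool}

theorem exists_card_le_two_mul_card_eq (c : V → Bool) :
    ∃ β, Fintype.card V ≤ 2 * #{v | c v = β} := by
  by_contra! h
  have hsum := card_eq_sum_card_fiberwise (s := (univ : Finset V)) (t := univ) (f := c)
    fun _ _ => mem_univ _
  rw [card_univ, Fintype.sum_bool] at hsum
  have := h true
  have := h false
  omega

theorem IsRobustExpander.joinsLargeSets {ε₁ ε₂ d : ℝ} (hε₁ : 0 < ε₁) (hε₁' : ε₁ < 1)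
    (hε₂ : 0 < ε₂) (hε₂' : ε₂ < 1) (hd : 0 < d) (h : IsRobustExpander G ε₁ (ε₂ * d))
    (hdeg : ∀ v, ⌈d⌉₊ ≤ G.degree v)
    (hreg : Regime (Fintype.card V) ⌈d⌉₊ (mParam (Fintype.card V) d))
    (hL₁ : 160 / ε₁ ≤ Real.log (Fintype.card V / d))
    (hL₂ : 15 / ε₂ ≤ Real.log (Fintype.card V / d)) :
    JoinsLargeSets C ⌈d⌉₊ (mParam (Fintype.card V) d) := by
  classical
  set L := Real.log (Fintype.card V / d)
  -- `log (15 x / (ε₂ d)) ≤ 2 L` for `d ≤ x ≤ n / 2`, so the expansion function is at least `1 / e`.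
  set e := ⌈4 * L ^ 2 / ε₁⌉₊
  have hL0 : 1 ≤ L := hL₁.trans' (by rw [one_le_div hε₁]; linarith)
  have he : 0 < e := Nat.ceil_pos.2 (by positivity)
  have hstep : L * (4 * e + 1) ≤ (mParam (Fintype.card V) d / 4 : ℕ) :=
    mul_four_mul_ceil_add_one_le hε₁ hε₁' hL₁
  have hem : (4 * e + 1 : ℝ) ≤ (mParam (Fintype.card V) d / 4 : ℕ) :=
    (le_mul_of_one_le_left (by positivity) hL0).trans hstep
  have hG : EdgeExpanding G ⌈d⌉₊ e := h.edgeExpanding hdeg (by nlinarith [Nat.le_ceil d])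
    fun x hx hxn => one_le_mul_expansion hε₁ hε₂ hε₂' hd hL₂ (Nat.le_ceil _)
      ((Nat.le_ceil d).trans hx) hxn
  refine hG.joinsLargeSets hreg he (r := mParam (Fintype.card V) d / 4) ?_ (by omega) ?_ C
  · have : 4 * e + 1 ≤ mParam (Fintype.card V) d / 4 := by exact_mod_cast hem
    omega
  · have hcard : (0 : ℝ) < Fintype.card V := by
      exact_mod_cast hreg.d_pos.trans_le (by simpa using hreg.mul_pow_le (Nat.zero_le 250))
    have hrounds := mul_pow_le_mul_succ_pow (a := 4 * e) hcard hd (by omega)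
      (by exact_mod_cast hstep)
    have hceil := hrounds.trans (mul_le_mul_of_nonneg_right (Nat.le_ceil d) (by positivity))
    exact_mod_cast hceil

theorem JoinsLargeSets.exists_containsTK {d m t : ℕ} (hjoin : JoinsLargeSets C d m)
    (hreg : Regime (Fintype.card V) d m) (hdeg : ∀ v, d ≤ G.degree v) (ht' : d ≤ t ^ 2)
    (ht : t ^ 2 ≤ 4 * d * m ^ 2) : ∃ ℓ, (ℓ = 1 ∨ ℓ + 1 = 80 * m ^ 3) ∧ ContainsTK G t ℓ := by
  classical
  by_cases hno : ContainsTK G t 1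
  · exact ⟨1, Or.inl rfl, hno⟩
  obtain ⟨β, hβ⟩ := exists_card_le_two_mul_card_eq C
  have ht0 : 0 < t := Nat.pos_of_ne_zero fun h => by
    have := hreg.d_pos
    simp [h] at ht'
    omega
  have hℓ : 80 * m ^ 3 - 1 + 1 = 80 * m ^ 3 :=
    Nat.sub_add_cancel (by have := pow_pos hreg.m_pos 3; omega)
  refine ⟨80 * m ^ 3 - 1, Or.inr hℓ, hjoin.containsTK (β := β) hreg ht' ht (fun U hU => ?_) hℓ⟩
  obtain ⟨v, hv, hvU, hstar⟩ := exists_star_avoiding hreg hdeg hβ ht0 ht hno hU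
  exact ⟨v, (mem_filter.1 hv).2, hvU, by omega⟩

end Dichotomy

end BalancedSubdivision

theorem mainTheorem2 (ε₁ ε₂ : ℝ) (hε₁ : 0 < ε₁) (hε₁' : ε₁ < 1) (hε₂ : 0 < ε₂) (hε₂' : ε₂ < 1) :
    ∃ K₀ : ℝ, ∀ K : ℝ, K₀ ≤ K →
      ∀ (V : Type*) [Fintype V] (G : SimpleGraph V) [DecidableRel G.Adj] (n : ℕ) (d : ℝ),
        Fintype.card V = n → 0 < d →
        G.IsBipartite →
        BalancedSubdivision.IsRobustExpander G ε₁ (ε₂ * d) →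
        d ≤ (G.minDegree : ℝ) →
        K * d ≤ (n : ℝ) →
        Real.log (n : ℝ) ^ 800 ≤ d →
        ∃ ℓ : ℕ,
          (ℓ = 1 ∨ ℓ + 1 = 80 * BalancedSubdivision.mParam n d ^ 3) ∧
          BalancedSubdivision.ContainsTK G ⌈Real.sqrt d * (BalancedSubdivision.mParam n d : ℝ)⌉₊ ℓ := by
  open BalancedSubdivision in
  obtain ⟨Λ, hΛ⟩ := exists_forall_two_mul_pow_le_exp 1000
  let L₀ := max Λ (max (160 / ε₁) (15 / ε₂))
  refine ⟨max (2 ^ 802) (Real.exp L₀), ?_⟩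
  rintro K hK V _ G _ n d rfl hd hbip hexp hmin hKd hlog
  classical
  have hdeg v : ⌈d⌉₊ ≤ G.degree v := (Nat.ceil_le.2 hmin).trans (G.minDegree_le_degree v)
  have hn : 2 ≤ Fintype.card V :=
    two_le_card_of_minDegree_pos (by exact_mod_cast hd.trans_le hmin)
  have hd1 : 1 ≤ d := one_le_of_log_pow_le hn ((le_max_left _ _).trans hK) hKd hlog
  have hratio : Real.exp L₀ ≤ Fintype.card V / d :=
    (le_max_right _ _).trans (hK.trans ((le_div_iff₀ hd).2 hKd))
  have hratio0 := (Real.exp_pos _).trans_le hratio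
  have hL : L₀ ≤ Real.log (Fintype.card V / d) := (Real.le_log_iff_exp_le hratio0).2 hratio
  obtain ⟨hL₀, hL₁, hL₂⟩ : Λ ≤ _ ∧ 160 / ε₁ ≤ _ ∧ 15 / ε₂ ≤ _ := by
    rwa [max_le_iff, max_le_iff] at hL
  have hreg : Regime (Fintype.card V) ⌈d⌉₊ (mParam (Fintype.card V) d) :=
    regime_mParam hd1 (hL₁.trans' (by rw [le_div_iff₀ hε₁]; linarith))
      ((hΛ _ hL₀).trans_eq (Real.exp_log hratio0)) hlog
  have hjoin := hexp.joinsLargeSets hε₁ hε₁' hε₂ hε₂' hd hdeg hreg hL₁ hL₂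
    (C := hbip.toColoring (by simp))
  have hm := hreg.le_m
  exact hjoin.exists_containsTK hreg hdeg (ceil_le_ceil_sqrt_mul_sq hd1 (by omega))
    (ceil_sqrt_mul_sq_le hd1 (by omega))
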